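/- **Setting.** Let $\mathcal X,\mathcal Y$ be Polish spaces, $\mathscr P(\cdot)$ the Borel probability measures with the narrow topology, $\mu\in\mathscr P(\mathcal X)$, and $c:\mathcal X\times\mathcal Y\to[0,+\infty]$ lower semicontinuous. Let $\mathscr P_\mu(\mathcal X\times\mathcal Y)$ be the set of $\gamma\in\mathscr P(\mathcal X\times\mathcal Y)$ with first marginal $\mu$. For $\mathcal E:\mathscr P(\mathcal Y)\to[0,+\infty]$ put $\mathcal J(\gamma)=\int c\,d\gamma+\mathcal E(\nu)$ if $\gamma\in\mathscr P_\mu(\mathcal X\times\mathcal Y)$ has second marginal $\nu$, and $\mathcal J(\gamma)=+\infty$ if $\gamma\notin\mathscr P_\mu(\mathcal X\times\mathcal Y)$. *First variation, critical point.* Let $\mathcal Z$ be a Polish space, $\mathscr F:\mathscr P(\mathcal Z)\to[0,+\infty]$ and $\operatorname{dom}\mathscr F=\{\mathscr F<+\infty\}$. A measurable $f:\mathcal Z\to\mathbb R\cup\{+\infty\}$ is a first variation of $\mathscr F$ at $m_0\in\operatorname{dom}\mathscr F$ if for every $m\in\operatorname{dom}\mathscr F$ one has $f\in L^1(m)$,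 $\mathscr F(m_0+\varepsilon(m-m_0))<\infty$ for small $\varepsilon>0$, and $$\frac{d}{d\varepsilon}\Big|_{\varepsilon=0^+}\mathscr F(m_0+\varepsilon(m-m_0))=\langle f,m-m_0\rangle:=\int f\,dm-\int f\,dm_0 .$$ The point $m_0$ is critical for $\mathscr F$ if $m_0\in\operatorname{dom}\mathscr F$, $\mathscr F$ has a first variation $f$ at $m_0$, and $\langle f,m-m_0\rangle\ge0$ for all $m\in\operatorname{dom}\mathscr F$. *Equilibria.* For $\Phi:\mathcal X\times\mathcal Y\times\mathscr P(\mathcal Y)\to\mathbb R\cup\{+\infty\}$, a measure $\gamma\in\mathscr P_\mu(\mathcal X\times\mathcal Y)$ with second marginal $\nu$ is a Cournot–Nash equilibrium if $y\in\operatorname{argmin}_{y'\in\mathcal Y}\Phi(x,y',\nu)$ for $\gamma$-a.e. $(x,y)$. It has finite social cost if $\int\Phi(x,y,\nu)\,d\gamma<+\infty$. A measure $\varrho\in\mathscr P(\mathcal Y)$ is a distribution of finite social cost for $\mu$ if there is $\kappa\in L^1(\mu)$ such that for $\mu$-a.e. $x$ some $y_x\in\mathcal Y$ satisfies $\Phi(x,y_x,\varrho)\le\kappa(x)$.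 **Theorem.** (i) Let $\mathcal E:\mathscr P(\mathcal Y)\to[0,+\infty]$ be lower semicontinuous, let $\gamma\in\mathscr P_\mu(\mathcal X\times\mathcal Y)$ have second marginal $\nu$, and suppose that $\mathcal E$ admits a first variation $\frac{\delta\mathcal E}{\delta\nu}(\nu)$ at $\nu$ such that, for every $\nu'\in\mathscr P(\mathcal Y)$ with $\frac{\delta\mathcal E}{\delta\nu}(\nu)\in L^1(\nu')$, $\mathcal E(\nu+t(\nu'-\nu))<+\infty$ for some $t\in(0,1]$ (automatic if $\mathcal E$ is finite-valued). Let $\Phi(x,y,\nu)=c(x,y)+\frac{\delta\mathcal E}{\delta\nu}(\nu)(y)$, and suppose that $(x,y)\mapsto\Phi(x,y,\nu)$ is lower semicontinuous and that $\{y:\Phi(x,y,\nu)\le\ell\}$ is compact for all $x\in\mathcal X$ and $\ell\in\mathbb R$. If $\mathcal J(\gamma)<+\infty$, then $\gamma$ is a Cournot–Nash equilibrium if and only if $\gamma$ is a critical point of $\mathcal J$. Moreover, whether or not $\mathcal J(\gamma)<+\infty$, if $\gamma$ is a Cournot–Nash equilibrium and $\nu$ is a distribution of finite social cost for $\mu$,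 then $\gamma$ has finite social cost. (ii) Let $L:\mathcal Y\to[0,+\infty]$ and $H:\mathcal Y\times\mathcal Y\to[0,+\infty]$ be lower semicontinuous, $H$ symmetric, and $\{L\le\kappa\}$ compact for every $\kappa>0$. Put $\mathcal H(\nu,\nu')=\int H\,d\nu\otimes\nu'$, $\mathcal E(\nu)=\int L\,d\nu+\mathcal H(\nu,\nu)$ and $\Phi(x,y,\nu)=c(x,y)+L(y)+2\int H(y,y')\,d\nu(y')$, and assume $\inf_{\mathscr P_\mu(\mathcal X\times\mathcal Y)}\mathcal J<+\infty$. Then $\mathcal J$ has a minimizer over $\mathscr P_\mu(\mathcal X\times\mathcal Y)$. If in addition for every $n\in\mathbb N$ there are $0<C_n<+\infty$ and a measurable family $(\nu_n^y)_{y\in\mathcal Y}\subset\mathscr P(\mathcal Y)$ such that for all $y'\in\mathcal Y$ and all $(x,y,\nu)$ with $\Phi(x,y,\nu)<+\infty$ $$\mathcal H(\nu_n^y,\nu_n^{y'})\le C_n\,(1+L(y)+L(y'))\ \text{ for all } n,\qquad \int_{\mathcal Y}\Phi(x,z,\nu)\,d\nu_n^y(z)\xrightarrow[n\to\infty]{}\Phi(x,y,\nu),$$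 then every minimizer of $\mathcal J$ over $\mathscr P_\mu(\mathcal X\times\mathcal Y)$ is a Cournot–Nash equilibrium for the cost $\Phi$. -/

import Mathlib

open MeasureTheory ProbabilityTheory Filter Topology
open scoped ENNReal NNReal

namespace CournotNash

noncomputable section

/-! ### First variations and critical points of functionals of probability measures -/

section FirstVariation

variable {Z : Type*} [MeasurableSpace Z]

/-- The point `(1 - t) μ₀ + t μ = μ₀ + t (μ - μ₀)` of the segment from `μ₀` to `μ`. -/
def convexMix (μ₀ μ : ProbabilityMeasure Z) (t : unitInterval) : ProbabilityMeasure Z :=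
  ⟨ENNReal.ofReal (1 - (t : ℝ)) • (μ₀ : Measure Z) + ENNReal.ofReal (t : ℝ) • (μ : Measure Z), by
    constructor
    have h0 : (0 : ℝ) ≤ 1 - (t : ℝ) := sub_nonneg.2 t.2.2
    simp [← ENNReal.ofReal_add h0 t.2.1]⟩

/-- Integrability of a function with values in `ℝ ∪ {+∞}`: it is a.e. finite, and its real-valued
version is integrable. -/
def ExtIntegrable (f : Z → EReal) (μ : ProbabilityMeasure Z) : Prop :=
  (∀ᵐ z ∂(μ : Measure Z), f z ≠ ⊤) ∧ Integrable (fun z => (f z).toReal) (μ : Measure Z)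

/-- The pairing `⟨f, μ - μ₀⟩ = ∫ f d(μ - μ₀)`; it is only used for `f` integrable with respect to
both measures. -/
def pairing (f : Z → EReal) (μ μ₀ : ProbabilityMeasure Z) : ℝ :=
  (∫ z, (f z).toReal ∂(μ : Measure Z)) - ∫ z, (f z).toReal ∂(μ₀ : Measure Z)

/-- `f : Z → ℝ ∪ {+∞}` is a first variation at `μ₀ ∈ dom F` of the functional `F` on
probability measures, with values in `[0, +∞]`: for every `μ ∈ dom F`, `f` is integrable along
`μ - μ₀`, and the right derivative at `0` of `ε ↦ F (μ₀ + ε (μ - μ₀))` is `⟨f, μ - μ₀⟩`. -/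
structure IsFirstVariation (F : ProbabilityMeasure Z → ℝ≥0∞) (μ₀ : ProbabilityMeasure Z)
    (f : Z → EReal) : Prop where
  mem_dom : F μ₀ < ⊤
  measurable : Measurable f
  ne_bot : ∀ z, f z ≠ ⊥
  integrable : ∀ μ, F μ < ⊤ → ExtIntegrable f μ
  eventually_finite : ∀ μ, F μ < ⊤ → ∀ᶠ t in 𝓝[>] (0 : unitInterval), F (convexMix μ₀ μ t) < ⊤
  hasDeriv : ∀ μ, F μ < ⊤ →
    Tendsto (fun t : unitInterval => ((F (convexMix μ₀ μ t)).toReal - (F μ₀).toReal) / (t : ℝ))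
      (𝓝[>] 0) (𝓝 (pairing f μ μ₀))

/-- `μ₀` is a critical point of `F`: `F` admits a first variation at `μ₀ ∈ dom F`, and it is
nonnegative along `μ - μ₀` for every `μ ∈ dom F`. -/
def IsCriticalPoint (F : ProbabilityMeasure Z → ℝ≥0∞) (μ₀ : ProbabilityMeasure Z) : Prop :=
  ∃ f : Z → EReal, IsFirstVariation F μ₀ f ∧ ∀ μ, F μ < ⊤ → 0 ≤ pairing f μ μ₀

end FirstVariation

section Game

variable {X Y : Type*} [MeasurableSpace X] [MeasurableSpace Y]

/-- First marginal. -/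
def margX (γ : ProbabilityMeasure (X × Y)) : ProbabilityMeasure X :=
  γ.map measurable_fst.aemeasurable

/-- Second marginal. -/
def margY (γ : ProbabilityMeasure (X × Y)) : ProbabilityMeasure Y :=
  γ.map measurable_snd.aemeasurable

/-- The set of plans with first marginal `μ`. -/
def plans (Y : Type*) [MeasurableSpace Y] (μ : ProbabilityMeasure X) :
    Set (ProbabilityMeasure (X × Y)) :=
  {γ | margX γ = μ}

/-! ### Cournot–Nash equilibria of the game with cost `Φ : X × Y × P(Y) → ℝ ∪ {+∞}` -/

/-- `γ` has first marginal `μ`, and for `γ`-a.e. `(x, y)` the strategy `y` minimizes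
`Φ(x, ·, ν)`, where `ν` is the second marginal of `γ`. -/
def IsCournotNash (Φ : X → Y → ProbabilityMeasure Y → EReal) (μ : ProbabilityMeasure X)
    (γ : ProbabilityMeasure (X × Y)) : Prop :=
  γ ∈ plans Y μ ∧
    ∀ᵐ p ∂(γ : Measure (X × Y)), ∀ y' : Y, Φ p.1 p.2 (margY γ) ≤ Φ p.1 y' (margY γ)

/-- `∫ Φ(x, y, ν) dγ < +∞`, that is, the positive part has a finite integral. -/
def HasFiniteSocialCost (Φ : X → Y → ProbabilityMeasure Y → EReal)
    (γ : ProbabilityMeasure (X × Y)) : Prop :=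
  ∫⁻ p, (Φ p.1 p.2 (margY γ)).toENNReal ∂(γ : Measure (X × Y)) < ⊤

/-- `ρ` is a distribution of finite social cost for the distribution of types `μ`. -/
def IsFiniteSocialCostDistribution (Φ : X → Y → ProbabilityMeasure Y → EReal)
    (μ : ProbabilityMeasure X) (ρ : ProbabilityMeasure Y) : Prop :=
  ∃ κ : X → ℝ, Integrable κ (μ : Measure X) ∧
    ∀ᵐ x ∂(μ : Measure X), ∃ y : Y, Φ x y ρ ≤ (κ x : EReal)

/-! ### Potential structure -/

/-- The cost `Φ(x, y, ν) = c(x, y) + δE/δν(ν)(y)`, where `dE ν` stands for the first variation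
at `ν`. -/
def potentialCost (c : X → Y → ℝ≥0∞) (dE : ProbabilityMeasure Y → Y → EReal) :
    X → Y → ProbabilityMeasure Y → EReal :=
  fun x y ν => (c x y : EReal) + dE ν y

open Classical in
/-- The lifted energy `J(γ) = ∫ c dγ + E(ν)` if `γ` has marginals `μ` and `ν`, and `+∞` if the
first marginal of `γ` is not `μ`. -/
def liftedEnergy (c : X → Y → ℝ≥0∞) (E : ProbabilityMeasure Y → ℝ≥0∞)
    (μ : ProbabilityMeasure X) (γ : ProbabilityMeasure (X × Y)) : ℝ≥0∞ :=
  if γ ∈ plans Y μ then (∫⁻ p, c p.1 p.2 ∂(γ : Measure (X × Y))) + E (margY γ) else ⊤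

/-- `γ` minimizes the functional `J` among the plans with first marginal `μ`. -/
def IsMinimizer (μ : ProbabilityMeasure X) (J : ProbabilityMeasure (X × Y) → ℝ≥0∞)
    (γ : ProbabilityMeasure (X × Y)) : Prop :=
  γ ∈ plans Y μ ∧ IsMinOn J (plans Y μ) γ

/-! ### Pairwise interactions -/

/-- `∫ H dν ⊗ ν'`. -/
def interaction (H : Y → Y → ℝ≥0∞) (ν ν' : ProbabilityMeasure Y) : ℝ≥0∞ :=
  ∫⁻ p, H p.1 p.2 ∂((ν : Measure Y).prod (ν' : Measure Y))

/-- `E(ν) = ∫ L dν + ∫ H dν ⊗ ν`. -/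
def pairwiseEnergy (L : Y → ℝ≥0∞) (H : Y → Y → ℝ≥0∞) (ν : ProbabilityMeasure Y) : ℝ≥0∞ :=
  (∫⁻ y, L y ∂(ν : Measure Y)) + interaction H ν ν

/-- `Φ(x, y, ν) = c(x, y) + L(y) + 2 ∫ H(y, y') dν(y')`. -/
def pairwiseCost (c : X → Y → ℝ≥0∞) (L : Y → ℝ≥0∞) (H : Y → Y → ℝ≥0∞) (x : X) (y : Y)
    (ν : ProbabilityMeasure Y) : ℝ≥0∞ :=
  c x y + L y + 2 * ∫⁻ y', H y y' ∂(ν : Measure Y)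

/-- The approximation condition: there are `0 < Cₙ < ∞` and measurable families `(νₙ^y)` of
probability measures on `Y` with `∫ H dνₙ^y ⊗ νₙ^y' ≤ Cₙ (1 + L(y) + L(y'))` and
`∫ Φ(x, z, ν) dνₙ^y(z) → Φ(x, y, ν)`, for all `y'` and all `(x, y, ν) ∈ dom Φ`. -/
def ApproximationCondition (c : X → Y → ℝ≥0∞) (L : Y → ℝ≥0∞) (H : Y → Y → ℝ≥0∞) : Prop :=
  ∃ (C : ℕ → ℝ≥0) (κ : ℕ → Kernel Y Y) (_ : ∀ n, IsMarkovKernel (κ n)),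
    (∀ n, 0 < C n) ∧
    ∀ (x : X) (y y' : Y) (ν : ProbabilityMeasure Y), pairwiseCost c L H x y ν < ⊤ →
      (∀ n, ∫⁻ p, H p.1 p.2 ∂((κ n y).prod (κ n y')) ≤ (C n : ℝ≥0∞) * (1 + L y + L y')) ∧
      Tendsto (fun n => ∫⁻ z, pairwiseCost c L H x z ν ∂(κ n y)) atTop
        (𝓝 (pairwiseCost c L H x y ν))

end Game

end

end CournotNash

/-!
# Cournot–Nash equilibria as critical points and minimizers

**Potential games.** Transport is affine along segments, so at a plan `γ` of finite energy the
function `Ψ = c + δE/δν` is a first variation of the lifted energy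
(`isFirstVariation_liftedEnergy`), and criticality says `∫ Ψ dγ ≤ ∫ Ψ dσ` for all `σ` of finite
energy. If `γ` charges only minimizers of `Ψ x ·`, this follows by disintegrating `γ` and `σ` over
their common first marginal (`pairing_nonneg_of_ae_minimal`). If it does not, a measurable selection
of strictly better strategies exists on a set of positive measure, and switching to them lowers the
integral (`ae_minimal_of_pairing_nonneg`).

The selection comes from descriptive set theory: the projection of a Borel set is analytic, hence
approximated from inside, in measure, by a continuous image of a compact set, on which least points
of fibres provide a section (`exists_measurable_selection`, `exists_measurable_improvement`).

**Pairwise interactions.** Minimizers exist by the direct method: integrals of lower semicontinuous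
functions are narrowly lower semicontinuous (`lowerSemicontinuous_lintegral`), and a bound on
`∫ L dν` makes the plans tight (`isCompact_plans_inter_lintegral_le`). Along a segment the energy is
a quadratic polynomial, so a minimizer satisfies `∫ Φ dγ ≤ ∫ Φ dσ` whenever the second marginal of
`σ` has finite self-interaction (`IsMinimizer.lintegral_pairwiseCost_le`). If a minimizer were not
an equilibrium, resampling the improved strategies from the approximating laws `νₙ^y` would produce
such a `σ` with a smaller integral (`IsMinimizer.isCournotNash`).
-/

namespace CournotNash

/-! ### Measurable selection on sets of positive measure -/

theorem isCompact_Iic_nat_pi (n : ℕ → ℕ) : IsCompact (Set.Iic n) := by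
  have : Set.Iic n = Set.pi Set.univ fun i => Set.Iic (n i) := by
    ext x; simp [Pi.le_def]
  rw [this]
  exact isCompact_univ_pi fun i => (Set.finite_Iic _).isCompact

/-- A continuous image of Baire space is approximated from inside, in outer measure, by images of
compact boxes `{x | ∀ i, x i ≤ n i}`. The bounds `n i` are chosen one coordinate at a time, by
continuity from below of the outer measure. -/
theorem exists_box_measure_image_ge {Z : Type*} [TopologicalSpace Z] [MeasurableSpace Z]
    {γ : Measure Z} [γ.OuterRegular] {h : (ℕ → ℕ) → Z} (hh : Continuous h)
    {r : ℝ≥0∞} (hr : r < γ (Set.range h)) :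
    ∃ n : ℕ → ℕ, r ≤ γ (h '' Set.Iic n) := by
  have step : ∀ (S : {S : Set (ℕ → ℕ) // r < γ (h '' S)}) (i : ℕ),
      ∃ m : ℕ, r < γ (h '' (S.1 ∩ {x | x i ≤ m})) := by
    rintro ⟨S, hS⟩ i
    have hmono : Monotone fun m : ℕ => h '' (S ∩ {x | x i ≤ m}) := fun a b hab =>
      Set.image_mono (Set.inter_subset_inter_right _ fun x (hx : x i ≤ a) => hx.trans hab)
    have hU : h '' S = ⋃ m : ℕ, h '' (S ∩ {x | x i ≤ m}) := by
      rw [← Set.image_iUnion, ← Set.inter_iUnion]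
      congr 1
      refine (Set.inter_eq_left.2 fun x _ => ?_).symm
      exact Set.mem_iUnion.2 ⟨x i, (le_rfl : x i ≤ x i)⟩
    rw [hU, hmono.measure_iUnion] at hS
    exact lt_iSup_iff.1 hS
  choose m hm using step
  let S : ℕ → {S : Set (ℕ → ℕ) // r < γ (h '' S)} := fun k =>
    Nat.rec ⟨Set.univ, by rwa [Set.image_univ]⟩ (fun i T => ⟨T.1 ∩ {x | x i ≤ m T i}, hm T i⟩) k
  have hS : ∀ k, (S k).1 = {x | ∀ i < k, x i ≤ m (S i) i} := by
    intro k
    induction k with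
    | zero => ext x; simp [S]
    | succ k ih =>
      have : (S (k + 1)).1 = (S k).1 ∩ {x | x k ≤ m (S k) k} := rfl
      rw [this, ih]
      ext x
      simp only [Set.mem_inter_iff, Set.mem_ofPred_eq, Nat.lt_succ_iff_lt_or_eq]
      constructor
      · rintro ⟨h1, h2⟩ i (hi | rfl)
        exacts [h1 i hi, h2]
      · exact fun H => ⟨fun i hi => H i (Or.inl hi), H k (Or.inr rfl)⟩
  set n : ℕ → ℕ := fun i => m (S i) i with hn
  refine ⟨n, ?_⟩
  -- An open set containing the image of the box contains the image of some `S k`: otherwise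
  -- truncating points of the `S k` outside its preimage gives a sequence in the box, with a limit
  -- point whose image is not in the open set.
  rw [Set.measure_eq_iInf_isOpen]
  refine le_iInf₂ fun U hU => le_iInf fun hUo => ?_
  suffices ∃ k, h '' (S k).1 ⊆ U by
    obtain ⟨k, hk⟩ := this
    exact (S k).2.le.trans (measure_mono hk)
  by_contra! hcon
  have hcon' : ∀ k, ∃ x ∈ (S k).1, h x ∉ U := fun k => by
    obtain ⟨_, ⟨x, hx, rfl⟩, hxU⟩ := Set.not_subset.1 (hcon k)
    exact ⟨x, hx, hxU⟩
  choose x hxS hxU using hcon'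
  have hy : ∀ k, (fun i => if i < k then x k i else 0) ∈ Set.Iic n := fun k i => by
    have := hxS k
    rw [hS k] at this
    by_cases hi : i < k
    · simpa [hi] using this i hi
    · simp [hi]
  obtain ⟨y, hyK, φ, hφ, hlim⟩ := (isCompact_Iic_nat_pi n).tendsto_subseq hy
  have hlim' : Tendsto (x ∘ φ) atTop (𝓝 y) := by
    rw [tendsto_pi_nhds] at hlim ⊢
    intro i
    refine (hlim i).congr' ?_
    filter_upwards [eventually_gt_atTop i] with j hj
    simp [hj.trans_le (hφ.id_le j)]
  have hyU : h y ∈ U := hU ⟨y, hyK, rfl⟩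
  obtain ⟨j, hj⟩ := (((hh.tendsto y).comp hlim').eventually (hUo.mem_nhds hyU)).exists
  exact hxU _ hj

/-- A continuous map on a compact set of reals has a measurable section on its range: take the
least point of each fibre. Its sublevel sets are images of compact sets. -/
theorem exists_measurable_section_of_compact_real {Z : Type*} [TopologicalSpace Z] [T2Space Z]
    [MeasurableSpace Z] [OpensMeasurableSpace Z] {C : Set ℝ} (hC : IsCompact C)
    (hne : C.Nonempty) {h : C → Z} (hh : Continuous h) :
    ∃ s : Z → C, Measurable s ∧ ∀ z ∈ Set.range h, h (s z) = z := by
  classical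
  have : CompactSpace C := isCompact_iff_compactSpace.1 hC
  have hleast : ∀ z ∈ Set.range h, ∃ t, IsLeast {t : C | h t = z} t := by
    rintro z ⟨t, ht⟩
    exact (isClosed_eq hh continuous_const).isCompact.exists_isLeast ⟨t, ht⟩
  let d : C := ⟨hne.some, hne.some_mem⟩
  let s : Z → C := fun z => if hz : z ∈ Set.range h then (hleast z hz).choose else d
  have hs : ∀ z (hz : z ∈ Set.range h), IsLeast {t : C | h t = z} (s z) := fun z hz => by
    simp only [s, hz, dif_pos]
    exact (hleast z hz).choose_spec
  have hcl : ∀ A : Set C, IsClosed A → MeasurableSet (h '' A) := fun A hA =>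
    (hA.isCompact.image hh).isClosed.measurableSet
  refine ⟨s, ?_, fun z hz => (hs z hz).1⟩
  suffices Measurable fun z => (s z : ℝ) from this.subtype_mk
  refine measurable_of_Iic fun a => ?_
  have hEq : (fun z => (s z : ℝ)) ⁻¹' Set.Iic a =
      h '' {t : C | (t : ℝ) ≤ a} ∪ ((Set.range h)ᶜ ∩ {_z | (d : ℝ) ≤ a}) := by
    ext z
    by_cases hz : z ∈ Set.range h
    · have := hs z hz
      simp only [Set.mem_preimage, Set.mem_Iic, Set.mem_union, Set.mem_inter_iff,
        Set.mem_compl_iff, hz, not_true_eq_false, false_and, or_false]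
      constructor
      · exact fun H => ⟨s z, H, this.1⟩
      · rintro ⟨t, ht, rfl⟩
        have : (s (h t) : ℝ) ≤ t := this.2 rfl
        exact this.trans ht
    · have h1 : z ∉ h '' {t : C | (t : ℝ) ≤ a} := fun ⟨t, _, ht⟩ => hz ⟨t, ht⟩
      have h2 : s z = d := by simp only [s, hz, dif_neg, not_false_eq_true]
      simp [h1, h2, hz, -Set.mem_range]
  rw [hEq]
  refine (hcl _ (isClosed_le continuous_subtype_val continuous_const)).union
    (MeasurableSet.inter ?_ (MeasurableSet.const _))
  rw [← Set.image_univ]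
  exact (hcl _ isClosed_univ).compl

/-- Measurable selection: if the projection to `Z` of a Borel set `M ⊆ Z × W` has positive outer
measure, then `M` contains the graph of a measurable function over a Borel set of positive
measure. -/
theorem exists_measurable_selection {Z W : Type*}
    [TopologicalSpace Z] [PolishSpace Z] [MeasurableSpace Z] [BorelSpace Z]
    [TopologicalSpace W] [PolishSpace W] [MeasurableSpace W] [BorelSpace W]
    (γ : Measure Z) [IsFiniteMeasure γ] {M : Set (Z × W)} (hM : MeasurableSet M)
    (hpos : γ (Prod.fst '' M) ≠ 0) :
    ∃ (K : Set Z) (s : Z → W), MeasurableSet K ∧ Measurable s ∧ γ K ≠ 0 ∧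
      ∀ z ∈ K, (z, s z) ∈ M := by
  have hA := hM.analyticSet
  rw [AnalyticSet] at hA
  rcases hA with rfl | ⟨g, hg, rfl⟩
  · simp at hpos
  let := TopologicalSpace.upgradeIsCompletelyMetrizable Z
  have hh : Continuous fun x => (g x).1 := continuous_fst.comp hg
  rw [← Set.range_comp] at hpos
  obtain ⟨r, hr0, hr⟩ := exists_between (pos_iff_ne_zero.2 hpos)
  obtain ⟨n, hn⟩ := exists_box_measure_image_ge hh hr
  set B : Set (ℕ → ℕ) := Set.Iic n
  have hB : IsCompact B := isCompact_Iic_nat_pi n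
  -- The box is a continuous image of the Cantor set, which is a compact set of reals.
  let : MetricSpace B := TopologicalSpace.metrizableSpaceMetric B
  have : CompactSpace B := isCompact_iff_compactSpace.1 hB
  have : Nonempty B := ⟨⟨n, (le_rfl : n ≤ n)⟩⟩
  obtain ⟨φ, hφ, hφs⟩ := exists_nat_bool_continuous_surjective_of_compact B
  let ψ : cantorSet → B := φ ∘ cantorSetHomeomorphNatToBool
  have hψ : Continuous ψ := hφ.comp cantorSetHomeomorphNatToBool.continuous
  have hψs : Function.Surjective ψ := hφs.comp cantorSetHomeomorphNatToBool.surjective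
  have hgψ : Continuous fun t => g (ψ t) := hg.comp (continuous_subtype_val.comp hψ)
  obtain ⟨s, hs, hsec⟩ := exists_measurable_section_of_compact_real isCompact_cantorSet
    ⟨0, zero_mem_cantorSet⟩ (h := fun t => (g (ψ t)).1) (continuous_fst.comp hgψ)
  have hrange : (fun x => (g x).1) '' B = Set.range fun t => (g (ψ t)).1 := by
    ext z
    constructor
    · rintro ⟨x, hx, rfl⟩
      obtain ⟨t, ht⟩ := hψs ⟨x, hx⟩
      exact ⟨t, by simp [ht]⟩
    · rintro ⟨t, rfl⟩
      exact ⟨_, (ψ t).2, rfl⟩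
  refine ⟨(fun x => (g x).1) '' B, fun z => (g (ψ (s z))).2,
    (hB.image hh).isClosed.measurableSet,
    ((continuous_snd.comp hgψ).measurable.comp hs), (hr0.trans_le hn).ne', fun z hz => ?_⟩
  rw [hrange] at hz
  exact ⟨ψ (s z), Prod.ext (hsec z hz) rfl⟩

/-- If a plan does not charge only the minimizers of `Ψ x ·`, then on a set of positive measure the
strategy can be changed measurably so that the cost drops across a fixed gap. -/
theorem exists_measurable_improvement {X Y : Type*}
    [TopologicalSpace X] [PolishSpace X] [MeasurableSpace X] [BorelSpace X]
    [TopologicalSpace Y] [PolishSpace Y] [MeasurableSpace Y] [BorelSpace Y]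
    (γ : Measure (X × Y)) [IsFiniteMeasure γ] {Ψ : X → Y → EReal}
    (hΨ : Measurable fun p : X × Y => Ψ p.1 p.2)
    (hne : ¬ ∀ᵐ p ∂γ, ∀ y', Ψ p.1 p.2 ≤ Ψ p.1 y') :
    ∃ (a b : ℝ) (K : Set (X × Y)) (s : X × Y → Y), a < b ∧ MeasurableSet K ∧ Measurable s ∧
      γ K ≠ 0 ∧ ∀ p ∈ K, Ψ p.1 (s p) ≤ a ∧ (b : EReal) < Ψ p.1 p.2 := by
  let M : ℚ × ℚ → Set ((X × Y) × Y) := fun q =>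
    {w | Ψ w.1.1 w.2 ≤ ((q.1 : ℝ) : EReal) ∧ ((q.2 : ℝ) : EReal) < Ψ w.1.1 w.1.2 ∧ q.1 < q.2}
  have hM : ∀ q, MeasurableSet (M q) := fun q => by
    have h1 : Measurable fun w : (X × Y) × Y => Ψ w.1.1 w.2 :=
      hΨ.comp (measurable_fst.fst.prodMk measurable_snd)
    have h2 : Measurable fun w : (X × Y) × Y => Ψ w.1.1 w.1.2 := hΨ.comp measurable_fst
    exact (measurableSet_le h1 measurable_const).inter
      ((measurableSet_lt measurable_const h2).inter (MeasurableSet.const _))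
  obtain ⟨q, hq⟩ : ∃ q, γ (Prod.fst '' M q) ≠ 0 := by
    by_contra! H
    refine hne (measure_mono_null ?_ (measure_iUnion_null H))
    intro p hp
    obtain ⟨y', hy'⟩ : ∃ y', Ψ p.1 y' < Ψ p.1 p.2 := by
      by_contra! h
      exact hp h
    obtain ⟨q₁, h1, h2⟩ := EReal.exists_rat_btwn_of_lt hy'
    obtain ⟨q₂, h3, h4⟩ := EReal.exists_rat_btwn_of_lt h2
    exact Set.mem_iUnion.2 ⟨(q₁, q₂), (p, y'), ⟨h1.le, h4, by exact_mod_cast h3⟩, rfl⟩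
  obtain ⟨K, s, hK, hs, hK0, hKs⟩ := exists_measurable_selection γ (hM q) hq
  have hlt : q.1 < q.2 := by
    obtain ⟨z, hz⟩ := nonempty_of_measure_ne_zero hK0
    exact (hKs z hz).2.2
  exact ⟨q.1, q.2, K, s, by exact_mod_cast hlt, hK, hs, hK0, fun p hp =>
    ⟨(hKs p hp).1, (hKs p hp).2.1⟩⟩

/-! ### Mixtures and the lifted energy -/

section Mix

variable {Z : Type*} [MeasurableSpace Z]

theorem coe_convexMix (μ₀ μ : ProbabilityMeasure Z) (t : unitInterval) :
    (convexMix μ₀ μ t : Measure Z) =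
      ENNReal.ofReal (1 - (t : ℝ)) • (μ₀ : Measure Z) + ENNReal.ofReal (t : ℝ) • (μ : Measure Z) :=
  rfl

theorem lintegral_convexMix (μ₀ μ : ProbabilityMeasure Z) (t : unitInterval) (f : Z → ℝ≥0∞) :
    ∫⁻ z, f z ∂(convexMix μ₀ μ t : Measure Z) =
      ENNReal.ofReal (1 - (t : ℝ)) * ∫⁻ z, f z ∂(μ₀ : Measure Z) +
        ENNReal.ofReal (t : ℝ) * ∫⁻ z, f z ∂(μ : Measure Z) := by
  rw [coe_convexMix, lintegral_add_measure, lintegral_smul_measure, lintegral_smul_measure]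
  rfl

theorem ExtIntegrable.convexMix {f : Z → EReal} {μ₀ μ : ProbabilityMeasure Z}
    (h₀ : ExtIntegrable f μ₀) (h : ExtIntegrable f μ) (t : unitInterval) :
    ExtIntegrable f (convexMix μ₀ μ t) := by
  refine ⟨?_, ?_⟩
  · rw [coe_convexMix, ae_add_measure_iff]
    exact ⟨Measure.ae_smul_measure h₀.1 _, Measure.ae_smul_measure h.1 _⟩
  · rw [coe_convexMix]
    exact (h₀.2.smul_measure ENNReal.ofReal_ne_top).add_measure
      (h.2.smul_measure ENNReal.ofReal_ne_top)

theorem pairing_convexMix {f : Z → EReal} {μ₀ μ : ProbabilityMeasure Z}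
    (h₀ : ExtIntegrable f μ₀) (h : ExtIntegrable f μ) (t : unitInterval) :
    pairing f (convexMix μ₀ μ t) μ₀ = t * pairing f μ μ₀ := by
  have h0 : (0 : ℝ) ≤ 1 - (t : ℝ) := sub_nonneg.2 t.2.2
  unfold pairing
  rw [coe_convexMix, integral_add_measure (h₀.2.smul_measure ENNReal.ofReal_ne_top)
    (h.2.smul_measure ENNReal.ofReal_ne_top), integral_smul_measure, integral_smul_measure,
    ENNReal.toReal_ofReal h0, ENNReal.toReal_ofReal t.2.1, smul_eq_mul, smul_eq_mul]
  ring

end Mix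

section Lifted

variable {X Y : Type*} [MeasurableSpace X] [MeasurableSpace Y]

theorem convexMix_mem_plans {μ : ProbabilityMeasure X} {γ σ : ProbabilityMeasure (X × Y)}
    (hγ : γ ∈ plans Y μ) (hσ : σ ∈ plans Y μ) (t : unitInterval) :
    convexMix γ σ t ∈ plans Y μ := by
  have h0 : (0 : ℝ) ≤ 1 - (t : ℝ) := sub_nonneg.2 t.2.2
  have h1 : (γ : Measure (X × Y)).map Prod.fst = μ := congrArg Subtype.val hγ
  have h2 : (σ : Measure (X × Y)).map Prod.fst = μ := congrArg Subtype.val hσ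
  refine Subtype.ext ?_
  change (convexMix γ σ t : Measure (X × Y)).map Prod.fst = μ
  rw [coe_convexMix, Measure.map_add _ _ measurable_fst, Measure.map_smul, Measure.map_smul, h1, h2,
    ← add_smul, ← ENNReal.ofReal_add h0 t.2.1]
  simp

theorem margY_convexMix (γ σ : ProbabilityMeasure (X × Y)) (t : unitInterval) :
    margY (convexMix γ σ t) = convexMix (margY γ) (margY σ) t := by
  refine Subtype.ext ?_
  change (convexMix γ σ t : Measure (X × Y)).map Prod.snd =
    ENNReal.ofReal (1 - (t : ℝ)) • (γ : Measure (X × Y)).map Prod.snd +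
      ENNReal.ofReal (t : ℝ) • (σ : Measure (X × Y)).map Prod.snd
  rw [coe_convexMix, Measure.map_add _ _ measurable_snd, Measure.map_smul, Measure.map_smul]

variable {c : X → Y → ℝ≥0∞} {E : ProbabilityMeasure Y → ℝ≥0∞} {μ : ProbabilityMeasure X}
  {γ σ : ProbabilityMeasure (X × Y)}

theorem liftedEnergy_of_mem (hγ : γ ∈ plans Y μ) :
    liftedEnergy c E μ γ = (∫⁻ p, c p.1 p.2 ∂(γ : Measure (X × Y))) + E (margY γ) :=
  if_pos hγ

theorem liftedEnergy_lt_top_iff :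
    liftedEnergy c E μ γ < ⊤ ↔
      γ ∈ plans Y μ ∧ ∫⁻ p, c p.1 p.2 ∂(γ : Measure (X × Y)) < ⊤ ∧ E (margY γ) < ⊤ := by
  by_cases h : γ ∈ plans Y μ
  · simp [liftedEnergy_of_mem h, h, ENNReal.add_lt_top]
  · simp [liftedEnergy, h]

theorem lintegral_convexMix_lt_top {f : X × Y → ℝ≥0∞}
    (hγ : ∫⁻ p, f p ∂(γ : Measure (X × Y)) < ⊤) (hσ : ∫⁻ p, f p ∂(σ : Measure (X × Y)) < ⊤)
    (t : unitInterval) : ∫⁻ p, f p ∂(convexMix γ σ t : Measure (X × Y)) < ⊤ := by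
  rw [lintegral_convexMix]
  exact ENNReal.add_lt_top.2 ⟨ENNReal.mul_lt_top ENNReal.ofReal_lt_top hγ,
    ENNReal.mul_lt_top ENNReal.ofReal_lt_top hσ⟩

/-! ### The first variation of the lifted energy -/

theorem ae_margY_iff {p : Y → Prop} (hp : MeasurableSet {y | p y}) :
    (∀ᵐ y ∂(margY γ : Measure Y), p y) ↔ ∀ᵐ q ∂(γ : Measure (X × Y)), p q.2 :=
  ae_map_iff measurable_snd.aemeasurable hp

/-- The real-valued version of `c + f` splits almost everywhere. -/
theorem toReal_add_ae_eq (hc : Measurable fun p : X × Y => c p.1 p.2)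
    (hcσ : ∫⁻ p, c p.1 p.2 ∂(σ : Measure (X × Y)) < ⊤) {f : Y → EReal} (hf : Measurable f)
    (hbot : ∀ y, f y ≠ ⊥) (hfσ : ExtIntegrable f (margY σ)) :
    (fun p : X × Y => ((c p.1 p.2 : EReal) + f p.2).toReal) =ᵐ[(σ : Measure (X × Y))]
      fun p => (c p.1 p.2).toReal + (f p.2).toReal := by
  have h1 := ae_lt_top hc hcσ.ne
  have h2 := (ae_margY_iff (hf (measurableSet_singleton ⊤)).compl).1 hfσ.1
  filter_upwards [h1, h2] with p hp1 hp2
  rw [EReal.toReal_add _ _ hp2 (hbot _), EReal.toReal_coe_ennreal]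
  · simpa using hp1.ne
  · simp

theorem extIntegrable_add (hc : Measurable fun p : X × Y => c p.1 p.2)
    (hcσ : ∫⁻ p, c p.1 p.2 ∂(σ : Measure (X × Y)) < ⊤) {f : Y → EReal} (hf : Measurable f)
    (hbot : ∀ y, f y ≠ ⊥) (hfσ : ExtIntegrable f (margY σ)) :
    ExtIntegrable (fun p : X × Y => (c p.1 p.2 : EReal) + f p.2) σ := by
  refine ⟨?_, ?_⟩
  · have h1 := ae_lt_top hc hcσ.ne
    have h2 := (ae_margY_iff (hf (measurableSet_singleton ⊤)).compl).1 hfσ.1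
    filter_upwards [h1, h2] with p hp1 hp2
    exact EReal.add_ne_top (by simpa using hp1.ne) hp2
  · refine Integrable.congr ?_ (toReal_add_ae_eq hc hcσ hf hbot hfσ).symm
    exact (integrable_toReal_of_lintegral_ne_top hc.aemeasurable hcσ.ne).add
      (hfσ.2.comp_measurable measurable_snd)

theorem integral_toReal_add (hc : Measurable fun p : X × Y => c p.1 p.2)
    (hcσ : ∫⁻ p, c p.1 p.2 ∂(σ : Measure (X × Y)) < ⊤) {f : Y → EReal} (hf : Measurable f)
    (hbot : ∀ y, f y ≠ ⊥) (hfσ : ExtIntegrable f (margY σ)) :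
    ∫ p, ((c p.1 p.2 : EReal) + f p.2).toReal ∂(σ : Measure (X × Y)) =
      (∫⁻ p, c p.1 p.2 ∂(σ : Measure (X × Y))).toReal +
        ∫ y, (f y).toReal ∂(margY σ : Measure Y) := by
  have h : Integrable (fun p : X × Y => (f p.2).toReal) (σ : Measure (X × Y)) :=
    hfσ.2.comp_measurable measurable_snd
  rw [integral_congr_ae (toReal_add_ae_eq hc hcσ hf hbot hfσ),
    integral_add (integrable_toReal_of_lintegral_ne_top hc.aemeasurable hcσ.ne) h,
    integral_toReal hc.aemeasurable (ae_lt_top hc hcσ.ne)]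
  congr 1
  exact (integral_map measurable_snd.aemeasurable hfσ.2.aestronglyMeasurable).symm

/-- At a plan of finite lifted energy, `c + δE/δν` is a first variation of the lifted energy: the
transport term is affine along segments, hence contributes exactly `∫ c d(σ - γ)`. -/
theorem isFirstVariation_liftedEnergy (hc : Measurable fun p : X × Y => c p.1 p.2)
    (hJ : liftedEnergy c E μ γ < ⊤) {f : Y → EReal} (hf : IsFirstVariation E (margY γ) f) :
    IsFirstVariation (liftedEnergy c E μ) γ (fun p : X × Y => (c p.1 p.2 : EReal) + f p.2) := by
  obtain ⟨hγ, hcγ, hEγ⟩ := liftedEnergy_lt_top_iff.1 hJ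
  have hfγ := hf.integrable _ hEγ
  refine ⟨hJ, ?_, ?_, ?_, ?_, ?_⟩
  · exact hc.coe_ereal_ennreal.add (hf.measurable.comp measurable_snd)
  · intro p
    simp [EReal.add_eq_bot_iff, hf.ne_bot]
  · intro σ hσJ
    obtain ⟨-, hcσ, hEσ⟩ := liftedEnergy_lt_top_iff.1 hσJ
    exact extIntegrable_add hc hcσ hf.measurable hf.ne_bot (hf.integrable _ hEσ)
  · intro σ hσJ
    obtain ⟨hσ, hcσ, hEσ⟩ := liftedEnergy_lt_top_iff.1 hσJ
    filter_upwards [hf.eventually_finite _ hEσ] with t ht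
    exact liftedEnergy_lt_top_iff.2 ⟨convexMix_mem_plans hγ hσ t,
      lintegral_convexMix_lt_top hcγ hcσ t, by rwa [margY_convexMix]⟩
  · intro σ hσJ
    obtain ⟨hσ, hcσ, hEσ⟩ := liftedEnergy_lt_top_iff.1 hσJ
    have hlim := (hf.hasDeriv _ hEσ).const_add
      ((∫⁻ p, c p.1 p.2 ∂(σ : Measure (X × Y))).toReal -
        (∫⁻ p, c p.1 p.2 ∂(γ : Measure (X × Y))).toReal)
    have hval : pairing (fun p : X × Y => (c p.1 p.2 : EReal) + f p.2) σ γ =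
        (∫⁻ p, c p.1 p.2 ∂(σ : Measure (X × Y))).toReal -
          (∫⁻ p, c p.1 p.2 ∂(γ : Measure (X × Y))).toReal + pairing f (margY σ) (margY γ) := by
      unfold pairing
      rw [integral_toReal_add hc hcσ hf.measurable hf.ne_bot (hf.integrable _ hEσ),
        integral_toReal_add hc hcγ hf.measurable hf.ne_bot hfγ]
      ring
    rw [hval]
    refine hlim.congr' ?_
    filter_upwards [hf.eventually_finite _ hEσ, self_mem_nhdsWithin] with t ht ht0
    have ht0' : (t : ℝ) ≠ 0 := (unitInterval.pos_iff_ne_zero.1 ht0 <| Subtype.ext ·)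
    have h0 : (0 : ℝ) ≤ 1 - (t : ℝ) := sub_nonneg.2 t.2.2
    rw [liftedEnergy_of_mem (convexMix_mem_plans hγ hσ t), liftedEnergy_of_mem hγ,
      margY_convexMix, ENNReal.toReal_add (lintegral_convexMix_lt_top hcγ hcσ t).ne ht.ne,
      ENNReal.toReal_add hcγ.ne hEγ.ne, lintegral_convexMix,
      ENNReal.toReal_add (ENNReal.mul_lt_top ENNReal.ofReal_lt_top hcγ).ne
        (ENNReal.mul_lt_top ENNReal.ofReal_lt_top hcσ).ne, ENNReal.toReal_mul, ENNReal.toReal_mul,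
      ENNReal.toReal_ofReal h0, ENNReal.toReal_ofReal t.2.1]
    field_simp
    ring

/-- Two first variations at the same point pair identically with admissible directions, since both
compute the same derivative. -/
theorem IsFirstVariation.pairing_eq {Z : Type*} [MeasurableSpace Z]
    {F : ProbabilityMeasure Z → ℝ≥0∞} {m₀ m : ProbabilityMeasure Z} {f g : Z → EReal}
    (hf : IsFirstVariation F m₀ f) (hg : IsFirstVariation F m₀ g) (hm : F m < ⊤) :
    pairing f m m₀ = pairing g m m₀ :=
  have : (𝓝[>] (0 : unitInterval)).NeBot := nhdsGT_neBot_of_exists_gt ⟨1, zero_lt_one⟩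
  tendsto_nhds_unique (hf.hasDeriv m hm) (hg.hasDeriv m hm)

end Lifted

/-! ### Equilibria and critical points of the lifted energy -/

/-- If `γ`-almost every pair minimizes `Ψ x ·`, then `γ` has the least total cost among the plans
with the same first marginal: disintegrating both plans over it, almost every pair of points of the
two fibres over `x` is ordered. In this form no measurability of `x ↦ inf Ψ x ·` is needed. -/
theorem pairing_nonneg_of_ae_minimal {X Y : Type*} [MeasurableSpace X] [MeasurableSpace Y]
    [StandardBorelSpace Y] {μ : ProbabilityMeasure X} {Ψ : X → Y → EReal}
    {γ σ : ProbabilityMeasure (X × Y)} (hγ : γ ∈ plans Y μ) (hσ : σ ∈ plans Y μ)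
    (hbot : ∀ x y, Ψ x y ≠ ⊥) (hγi : ExtIntegrable (fun p : X × Y => Ψ p.1 p.2) γ)
    (hσi : ExtIntegrable (fun p : X × Y => Ψ p.1 p.2) σ)
    (hmin : ∀ᵐ p ∂(γ : Measure (X × Y)), ∀ y', Ψ p.1 p.2 ≤ Ψ p.1 y') :
    0 ≤ pairing (fun p : X × Y => Ψ p.1 p.2) σ γ := by
  have : Nonempty Y := (nonempty_of_isProbabilityMeasure (γ : Measure (X × Y))).map Prod.snd
  have key : ∀ τ : ProbabilityMeasure (X × Y), τ ∈ plans Y μ →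
      ∃ κ : Kernel X Y, IsMarkovKernel κ ∧ (τ : Measure (X × Y)) = (μ : Measure X) ⊗ₘ κ := by
    intro τ hτ
    have h1 : (τ : Measure (X × Y)).fst = μ := congrArg Subtype.val hτ
    refine ⟨(τ : Measure (X × Y)).condKernel, inferInstance, ?_⟩
    rw [← h1]
    exact ((τ : Measure (X × Y)).disintegrate _).symm
  obtain ⟨κ, _, hκ⟩ := key γ hγ
  obtain ⟨η, _, hη⟩ := key σ hσ
  obtain ⟨hγt, hγi⟩ := hγi
  obtain ⟨hσt, hσi⟩ := hσi
  unfold pairing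
  rw [hκ] at hγt hγi hmin ⊢
  rw [hη] at hσt hσi ⊢
  rw [Measure.integral_compProd hγi, Measure.integral_compProd hσi, sub_nonneg]
  have hγi' := (Measure.integrable_compProd_iff hγi.aestronglyMeasurable).1 hγi
  have hσi' := (Measure.integrable_compProd_iff hσi.aestronglyMeasurable).1 hσi
  have hγint := Integrable.integral_compProd (κ := Kernel.const Unit (μ : Measure X)) (a := ()) hγi
  have hσint := Integrable.integral_compProd (κ := Kernel.const Unit (μ : Measure X)) (a := ()) hσi
  refine integral_mono_ae hγint hσint ?_
  filter_upwards [hγi'.1, hσi'.1, Measure.ae_ae_of_ae_compProd hmin,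
    Measure.ae_ae_of_ae_compProd hσt] with x hx1 hx2 hx3 hx4
  -- The value on the fibre of `γ` is a lower bound for almost all of the fibre of `σ`.
  have hle : ∀ᵐ y ∂κ x, (Ψ x y).toReal ≤ ∫ y', (Ψ x y').toReal ∂η x := by
    filter_upwards [hx3] with y hy
    have h : ∫ _y', (Ψ x y).toReal ∂η x ≤ ∫ y', (Ψ x y').toReal ∂η x := by
      refine integral_mono_ae (integrable_const _) hx2 ?_
      filter_upwards [hx4] with y' hy'
      exact EReal.toReal_le_toReal (hy y') (hbot _ _) hy'
    simpa using h
  have h := integral_mono_ae hx1 (integrable_const _) hle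
  simpa using h

section Potential

variable {X Y : Type*} [TopologicalSpace X] [PolishSpace X] [MeasurableSpace X] [BorelSpace X]
    [TopologicalSpace Y] [PolishSpace Y] [MeasurableSpace Y] [BorelSpace Y]

variable {c : X → Y → ℝ≥0∞} {E : ProbabilityMeasure Y → ℝ≥0∞} {μ : ProbabilityMeasure X}
  {γ : ProbabilityMeasure (X × Y)}

/-- A plan of finite energy with `0 ≤ ⟨Ψ, σ - γ⟩` for all competitors `σ` of finite energy, where
`Ψ = c + δE/δν`, charges only minimizers of `Ψ x ·`. Otherwise switch, on a set where everything
stays bounded, to a better strategy; the resulting plan need not have finite energy, but some point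
on the segment towards it does, and `⟨Ψ, ·⟩` is linear along the segment. -/
theorem ae_minimal_of_pairing_nonneg (hc : Measurable fun p : X × Y => c p.1 p.2)
    (hJ : liftedEnergy c E μ γ < ⊤) {f : Y → EReal} (hf : IsFirstVariation E (margY γ) f)
    (hadm : ∀ ν' : ProbabilityMeasure Y, ExtIntegrable f ν' →
      ∃ t : unitInterval, 0 < t ∧ E (convexMix (margY γ) ν' t) < ⊤)
    (hpair : ∀ σ, liftedEnergy c E μ σ < ⊤ →
      0 ≤ pairing (fun p : X × Y => (c p.1 p.2 : EReal) + f p.2) σ γ) :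
    ∀ᵐ p ∂(γ : Measure (X × Y)), ∀ y', (c p.1 p.2 : EReal) + f p.2 ≤ (c p.1 y' : EReal) + f y' := by
  classical
  by_contra hne
  obtain ⟨hγ, hcγ, hEγ⟩ := liftedEnergy_lt_top_iff.1 hJ
  have hfγ := hf.integrable _ hEγ
  set Ψ : X → Y → EReal := fun x y => (c x y : EReal) + f y with hΨdef
  have hΨ : Measurable fun p : X × Y => Ψ p.1 p.2 :=
    hc.coe_ereal_ennreal.add (hf.measurable.comp measurable_snd)
  have hΨbot : ∀ x y, Ψ x y ≠ ⊥ := fun x y => by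
    simp [hΨdef, EReal.add_eq_bot_iff, hf.ne_bot]
  obtain ⟨a, b, K, s, hab, hK, hs, hK0, hKs⟩ :=
    exists_measurable_improvement (γ : Measure (X × Y)) hΨ hne
  -- Cut down `K` so that `f ∘ s` is bounded below on it; then `c` and `f` are bounded along `s`.
  obtain ⟨m, hm⟩ : ∃ m : ℝ, (γ : Measure (X × Y)) (K ∩ {p | (m : EReal) ≤ f (s p)}) ≠ 0 := by
    by_contra! H
    refine hK0 (measure_mono_null ?_ (measure_iUnion_null fun n : ℕ => H (-(n : ℝ))))
    intro p hp
    obtain ⟨r, hr⟩ : ∃ r : ℝ, (r : EReal) ≤ f (s p) := by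
      obtain ⟨r, _, hr⟩ := EReal.lt_iff_exists_real_btwn.1 (bot_lt_iff_ne_bot.2 (hf.ne_bot (s p)))
      exact ⟨r, hr.le⟩
    obtain ⟨n, hn⟩ := exists_nat_ge (-r)
    refine Set.mem_iUnion.2 ⟨n, hp, le_trans ?_ hr⟩
    exact_mod_cast (by linarith : -(n : ℝ) ≤ r)
  set A : Set (X × Y) := K ∩ {p | (m : EReal) ≤ f (s p)} with hA
  have hAm : MeasurableSet A :=
    hK.inter (measurableSet_le measurable_const (hf.measurable.comp hs))
  have hbd : ∀ p ∈ A, c p.1 (s p) ≤ ENNReal.ofReal (a - m) ∧ f (s p) ≤ a ∧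
      (m : EReal) ≤ f (s p) := by
    rintro p ⟨hpK, hpm⟩
    have h1 : (c p.1 (s p) : EReal) + f (s p) ≤ a := (hKs p hpK).1
    have h0 : (0 : EReal) ≤ (c p.1 (s p) : EReal) := EReal.coe_ennreal_nonneg _
    refine ⟨?_, ?_, hpm⟩
    · have h2 : (c p.1 (s p) : EReal) + (m : EReal) ≤ a :=
        (add_le_add_right hpm _).trans h1
      have h3 : (c p.1 (s p) : EReal) ≤ ((a - m : ℝ) : EReal) := by
        rw [EReal.coe_sub]
        exact EReal.le_sub_iff_add_le (Or.inl (EReal.coe_ne_bot m))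
          (Or.inl (EReal.coe_ne_top m)) |>.2 h2
      have := EReal.toENNReal_le_toENNReal h3
      rwa [EReal.toENNReal_coe, EReal.toENNReal_of_ne_top (EReal.coe_ne_top _),
        EReal.toReal_coe] at this
    · calc f (s p) = 0 + f (s p) := (zero_add _).symm
        _ ≤ (c p.1 (s p) : EReal) + f (s p) := add_le_add_left h0 _
        _ ≤ a := h1
  let T : X × Y → X × Y := fun p => (p.1, if p ∈ A then s p else p.2)
  have hT : Measurable T := measurable_fst.prodMk (Measurable.ite hAm hs measurable_snd)
  have hTA : ∀ p ∈ A, T p = (p.1, s p) := fun p hp => by simp [T, hp]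
  have hTA' : ∀ p ∉ A, T p = p := fun p hp => by simp [T, hp]
  let σ : ProbabilityMeasure (X × Y) := γ.map hT.aemeasurable
  have hσ_coe : (σ : Measure (X × Y)) = (γ : Measure (X × Y)).map T := rfl
  have hσ : σ ∈ plans Y μ := by
    have h1 : (γ : Measure (X × Y)).map Prod.fst = μ := congrArg Subtype.val hγ
    refine Subtype.ext ?_
    change ((γ : Measure (X × Y)).map T).map Prod.fst = μ
    rw [Measure.map_map measurable_fst hT, ← h1]
    rfl
  have hcσ : ∫⁻ p, c p.1 p.2 ∂(σ : Measure (X × Y)) < ⊤ := by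
    rw [hσ_coe, lintegral_map hc hT]
    calc ∫⁻ p, c (T p).1 (T p).2 ∂(γ : Measure (X × Y))
        ≤ ∫⁻ p, (ENNReal.ofReal (a - m) + c p.1 p.2) ∂(γ : Measure (X × Y)) := by
          refine lintegral_mono fun p => ?_
          by_cases hp : p ∈ A
          · rw [hTA p hp]
            exact (hbd p hp).1.trans le_self_add
          · rw [hTA' p hp]
            exact le_add_self
      _ < ⊤ := by
          rw [lintegral_add_left measurable_const]
          simpa using hcγ
  have hfσ : ExtIntegrable f (margY σ) := by
    have hcoe : (margY σ : Measure Y) = (γ : Measure (X × Y)).map fun p => (T p).2 :=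
      Measure.map_map measurable_snd hT
    have hT2 : Measurable fun p => (T p).2 := measurable_snd.comp hT
    refine ⟨?_, ?_⟩
    · rw [hcoe]
      refine (ae_map_iff hT2.aemeasurable (hf.measurable (measurableSet_singleton ⊤)).compl).2 ?_
      filter_upwards [(ae_margY_iff (hf.measurable (measurableSet_singleton ⊤)).compl).1 hfγ.1]
        with p hp
      by_cases hpA : p ∈ A
      · rw [hTA p hpA]
        exact ne_top_of_le_ne_top (EReal.coe_ne_top a) (hbd p hpA).2.1
      · rwa [hTA' p hpA]
    · rw [hcoe, integrable_map_measure hf.measurable.ereal_toReal.aestronglyMeasurable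
        hT2.aemeasurable]
      have hint : Integrable (fun p : X × Y => (f p.2).toReal) (γ : Measure (X × Y)) :=
        hfγ.2.comp_measurable measurable_snd
      refine (hint.abs.add (integrable_const (|a| + |m|))).mono'
        (hf.measurable.ereal_toReal.comp hT2).aestronglyMeasurable (ae_of_all _ fun p => ?_)
      rw [Function.comp_apply, Real.norm_eq_abs]
      by_cases hpA : p ∈ A
      · rw [hTA p hpA]
        obtain ⟨-, h1, h2⟩ := hbd p hpA
        have h3 : (f (s p)).toReal ≤ a := by
          have := EReal.toReal_le_toReal h1 (hf.ne_bot _) (EReal.coe_ne_top a)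
          simpa using this
        have h4 : m ≤ (f (s p)).toReal := by
          have := EReal.toReal_le_toReal h2 (EReal.coe_ne_bot _)
            (ne_top_of_le_ne_top (EReal.coe_ne_top a) h1)
          simpa using this
        have : |(f (s p)).toReal| ≤ |a| + |m| := by
          rw [abs_le]
          constructor
          · linarith [abs_nonneg a, neg_abs_le m]
          · linarith [le_abs_self a, abs_nonneg m]
        exact this.trans (le_add_of_nonneg_left (abs_nonneg _))
      · rw [hTA' p hpA]
        exact le_add_of_nonneg_right (by positivity)
  have hΨγ := extIntegrable_add hc hcγ hf.measurable hf.ne_bot hfγ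
  have hΨσ := extIntegrable_add hc hcσ hf.measurable hf.ne_bot hfσ
  obtain ⟨t, ht0, ht⟩ := hadm _ hfσ
  have hmix := hpair (convexMix γ σ t) (liftedEnergy_lt_top_iff.2 ⟨convexMix_mem_plans hγ hσ t,
    lintegral_convexMix_lt_top hcγ hcσ t, by rwa [margY_convexMix]⟩)
  rw [pairing_convexMix hΨγ hΨσ] at hmix
  have ht0' : (0 : ℝ) < t := ht0
  have hge : 0 ≤ pairing (fun p : X × Y => Ψ p.1 p.2) σ γ := nonneg_of_mul_nonneg_right hmix ht0'
  -- Switching from `T` back to the identity costs at least `b - a` on `A`.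
  have hint₁ : Integrable (fun p => (Ψ (T p).1 (T p).2).toReal) (γ : Measure (X × Y)) :=
    (integrable_map_measure hΨ.ereal_toReal.aestronglyMeasurable hT.aemeasurable).1 hΨσ.2
  have hlt : ∫ p, (Ψ (T p).1 (T p).2).toReal ∂(γ : Measure (X × Y)) ≤
      ∫ p, (Ψ p.1 p.2).toReal ∂(γ : Measure (X × Y)) -
        (γ : Measure (X × Y)).real A * (b - a) := by
    have hind : Integrable (A.indicator fun _ => b - a) (γ : Measure (X × Y)) :=
      (integrable_const _).indicator hAm
    have h1 : ∫ p, A.indicator (fun _ => b - a) p ∂(γ : Measure (X × Y)) =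
        (γ : Measure (X × Y)).real A * (b - a) := by
      rw [integral_indicator hAm]
      simp
    rw [← h1, ← integral_sub hΨγ.2 hind]
    refine integral_mono_ae hint₁ (hΨγ.2.sub hind) ?_
    filter_upwards [hΨγ.1] with p hp
    by_cases hpA : p ∈ A
    · obtain ⟨h1, h2⟩ := hKs p hpA.1
      have h3 := EReal.toReal_le_toReal h1 (hΨbot _ _) (EReal.coe_ne_top a)
      have h4 := EReal.toReal_le_toReal h2.le (EReal.coe_ne_bot b) hp
      simp only [EReal.toReal_coe] at h3 h4
      simp only [hTA p hpA, Set.indicator_of_mem hpA]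
      change _ ≤ (Ψ p.1 p.2).toReal - _
      linarith
    · simp [hTA' p hpA, Set.indicator_of_notMem hpA, hΨdef]
  have hpos : 0 < (γ : Measure (X × Y)).real A * (b - a) :=
    mul_pos (ENNReal.toReal_pos hm (measure_ne_top _ _)) (sub_pos.2 hab)
  have hσint : ∫ p, (Ψ p.1 p.2).toReal ∂(σ : Measure (X × Y)) =
      ∫ p, (Ψ (T p).1 (T p).2).toReal ∂(γ : Measure (X × Y)) :=
    integral_map hT.aemeasurable hΨ.ereal_toReal.aestronglyMeasurable
  unfold pairing at hge
  rw [hσint] at hge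
  linarith

/-- For a potential game, equilibria of finite energy are the critical points of the lifted
energy. -/
theorem isCournotNash_iff_isCriticalPoint (hc : Measurable fun p : X × Y => c p.1 p.2)
    {dE : ProbabilityMeasure Y → Y → EReal}
    (hf : IsFirstVariation E (margY γ) (dE (margY γ)))
    (hadm : ∀ ν' : ProbabilityMeasure Y, ExtIntegrable (dE (margY γ)) ν' →
      ∃ t : unitInterval, 0 < t ∧ E (convexMix (margY γ) ν' t) < ⊤)
    (hJ : liftedEnergy c E μ γ < ⊤) :
    IsCournotNash (potentialCost c dE) μ γ ↔ IsCriticalPoint (liftedEnergy c E μ) γ := by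
  have hfv := isFirstVariation_liftedEnergy hc hJ hf
  have hγ := (liftedEnergy_lt_top_iff.1 hJ).1
  constructor
  · rintro ⟨-, hmin⟩
    refine ⟨_, hfv, fun σ hσ => ?_⟩
    exact pairing_nonneg_of_ae_minimal (Ψ := fun x y => (c x y : EReal) + dE (margY γ) y) hγ
      (liftedEnergy_lt_top_iff.1 hσ).1 (fun x y => hfv.ne_bot (x, y)) (hfv.integrable _ hJ)
      (hfv.integrable _ hσ) hmin
  · rintro ⟨g, hg, hpair⟩
    refine ⟨hγ, ae_minimal_of_pairing_nonneg hc hJ hf hadm fun σ hσ => ?_⟩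
    rw [hfv.pairing_eq hg hσ]
    exact hpair σ hσ

end Potential

theorem IsCournotNash.hasFiniteSocialCost {X Y : Type*} [MeasurableSpace X] [MeasurableSpace Y]
    {μ : ProbabilityMeasure X} {γ : ProbabilityMeasure (X × Y)}
    {Φ : X → Y → ProbabilityMeasure Y → EReal}
    (h : IsCournotNash Φ μ γ) (hfin : IsFiniteSocialCostDistribution Φ μ (margY γ)) :
    HasFiniteSocialCost Φ γ := by
  obtain ⟨hγ, hmin⟩ := h
  obtain ⟨κ, hκ, hle⟩ := hfin
  have h1 : (γ : Measure (X × Y)).map Prod.fst = μ := congrArg Subtype.val hγ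
  rw [← h1] at hκ hle
  have hle' := ae_of_ae_map measurable_fst.aemeasurable hle
  have hκ' := hκ.comp_measurable measurable_fst
  refine lt_of_le_of_lt (lintegral_mono_ae ?_) hκ'.lintegral_lt_top
  filter_upwards [hmin, hle'] with p hp hp'
  obtain ⟨y, hy⟩ := hp'
  simpa using EReal.toENNReal_le_toENNReal ((hp y).trans hy)

/-! ### Existence of minimizers -/

/-- One half of the portmanteau theorem: the integral of a nonnegative lower semicontinuous
function is lower semicontinuous for the narrow topology. By truncation and the layer-cake formula,
this reduces to `m ↦ m U` for open sets `U`. -/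
theorem lowerSemicontinuous_lintegral {Z : Type*} [TopologicalSpace Z] [PolishSpace Z]
    [MeasurableSpace Z] [BorelSpace Z] {f : Z → ℝ≥0∞} (hf : LowerSemicontinuous f) :
    LowerSemicontinuous fun m : ProbabilityMeasure Z => ∫⁻ z, f z ∂(m : Measure Z) := by
  have hsup : ∀ m : ProbabilityMeasure Z, ∫⁻ z, f z ∂(m : Measure Z) =
      ⨆ n : ℕ, ∫⁻ z, min (f z) n ∂(m : Measure Z) := fun m => by
    rw [← lintegral_iSup (fun n => hf.measurable.min measurable_const)
      (fun a b hab z => min_le_min_left _ (by exact_mod_cast hab))]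
    refine lintegral_congr fun z => ?_
    rw [← inf_iSup_eq, ENNReal.iSup_natCast, inf_top_eq]
  simp_rw [hsup]
  refine lowerSemicontinuous_iSup fun n => ?_
  let g : Z → ℝ := fun z => (min (f z) n).toReal
  have hgm : Measurable g := (hf.measurable.min measurable_const).ennreal_toReal
  have hne : ∀ z, min (f z) n ≠ ⊤ := fun z =>
    ne_top_of_le_ne_top (ENNReal.natCast_ne_top n) (min_le_right _ _)
  have hg : ∀ z, min (f z) n = ENNReal.ofReal (g z) := fun z => (ENNReal.ofReal_toReal (hne z)).symm
  simp_rw [hg]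
  rw [lowerSemicontinuous_iff_isClosed_preimage]
  intro a
  refine IsSeqClosed.isClosed fun ms m hms hlim => ?_
  have hopen : ∀ t ∈ Set.Ioi (0 : ℝ), (m : Measure Z) {z | t < g z} ≤
      atTop.liminf fun i => (ms i : Measure Z) {z | t < g z} := fun t ht => by
    refine ProbabilityMeasure.le_liminf_measure_open_of_tendsto hlim ?_
    have : {z | t < g z} = {z | ENNReal.ofReal t < f z} ∩ {_z | ENNReal.ofReal t < n} := by
      ext z
      change t < (min (f z) n).toReal ↔ ENNReal.ofReal t < f z ∧ ENNReal.ofReal t < n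
      rw [← lt_min_iff, ENNReal.ofReal_lt_iff_lt_toReal (le_of_lt ht) (hne z)]
    rw [this]
    exact (hf.isOpen_preimage _).inter isOpen_const
  have hle : ∫⁻ z, ENNReal.ofReal (g z) ∂(m : Measure Z) ≤
      atTop.liminf fun i => ∫⁻ z, ENNReal.ofReal (g z) ∂(ms i : Measure Z) := by
    have hlayer : ∀ m : ProbabilityMeasure Z, ∫⁻ z, ENNReal.ofReal (g z) ∂(m : Measure Z) =
        ∫⁻ t in Set.Ioi (0 : ℝ), (m : Measure Z) {z | t < g z} := fun m =>
      lintegral_eq_lintegral_meas_lt _ (Eventually.of_forall fun z => ENNReal.toReal_nonneg)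
        hgm.aemeasurable
    simp_rw [hlayer]
    refine (setLIntegral_mono' measurableSet_Ioi hopen).trans ?_
    exact lintegral_liminf_le fun i => Antitone.measurable fun s t hst =>
      measure_mono fun z hz => lt_of_le_of_lt hst hz
  refine hle.trans ?_
  exact liminf_le_of_frequently_le' (Frequently.of_forall hms)

section Existence

variable {X Y : Type*} [TopologicalSpace X] [PolishSpace X] [MeasurableSpace X] [BorelSpace X]
    [TopologicalSpace Y] [PolishSpace Y] [MeasurableSpace Y] [BorelSpace Y]

/-- Plans with a given first marginal and a bound on `∫ L dν` form a narrowly compact set when `L`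
has compact sublevels: both marginals are tight. -/
theorem isCompact_plans_inter_lintegral_le (μ : ProbabilityMeasure X) {L : Y → ℝ≥0∞}
    (hL : LowerSemicontinuous L) (hcpt : ∀ κ : ℝ≥0, 0 < κ → IsCompact {y : Y | L y ≤ (κ : ℝ≥0∞)})
    {a : ℝ≥0∞} (ha : a ≠ ⊤) :
    IsCompact (plans Y μ ∩
      {γ : ProbabilityMeasure (X × Y) | ∫⁻ p, L p.2 ∂(γ : Measure (X × Y)) ≤ a}) := by
  have hclosed : IsClosed (plans Y μ ∩
      {γ : ProbabilityMeasure (X × Y) | ∫⁻ p, L p.2 ∂(γ : Measure (X × Y)) ≤ a}) := by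
    refine IsClosed.inter ?_ ?_
    · exact isClosed_singleton.preimage (ProbabilityMeasure.continuous_map continuous_fst)
    · exact (lowerSemicontinuous_lintegral (hL.comp continuous_snd)).isClosed_preimage a
  rw [← hclosed.closure_eq]
  apply isCompact_closure_of_isTightMeasureSet
  apply IsTightMeasureSet.prodMk
  · refine (isTightMeasureSet_singleton (μ := (μ : Measure X))).subset ?_
    rintro _ ⟨_, ⟨γ, ⟨hγ, -⟩, rfl⟩, rfl⟩
    exact congrArg Subtype.val hγ
  · rw [isTightMeasureSet_iff_exists_isCompact_measure_compl_le]
    intro ε hε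
    rcases eq_or_ne ε ⊤ with rfl | hε'
    · exact ⟨∅, isCompact_empty, fun _ _ => le_top⟩
    -- Markov's inequality on `{L > κ}` with `κ = a / ε + 1`.
    have hκ : a / ε + 1 ≠ ⊤ := by
      simp [ENNReal.div_eq_top, hε.ne', ha]
    refine ⟨_, hcpt (a / ε + 1).toNNReal (ENNReal.toNNReal_pos (by simp) hκ), ?_⟩
    rintro _ ⟨_, ⟨γ, ⟨-, hγ⟩, rfl⟩, rfl⟩
    rw [ENNReal.coe_toNNReal hκ]
    have h1 : (a / ε + 1) * (γ : Measure (X × Y)).snd {y | a / ε + 1 ≤ L y} ≤ a := by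
      refine (mul_meas_ge_le_lintegral hL.measurable _).trans ?_
      rw [Measure.snd, lintegral_map hL.measurable measurable_snd]
      exact hγ
    have h2 : (γ : Measure (X × Y)).snd {y | L y ≤ a / ε + 1}ᶜ ≤
        (γ : Measure (X × Y)).snd {y | a / ε + 1 ≤ L y} :=
      measure_mono fun y (hy : ¬ L y ≤ a / ε + 1) => (not_le.1 hy).le
    refine h2.trans ?_
    have h3 : (γ : Measure (X × Y)).snd {y | a / ε + 1 ≤ L y} ≤ a / (a / ε + 1) := by
      rw [ENNReal.le_div_iff_mul_le (Or.inl (by simp)) (Or.inl hκ), mul_comm]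
      exact h1
    refine h3.trans (ENNReal.div_le_of_le_mul ?_)
    rw [mul_add, ENNReal.mul_div_cancel hε.ne' hε']
    exact le_self_add

theorem lowerSemicontinuous_pairwiseEnergy {L : Y → ℝ≥0∞} {H : Y → Y → ℝ≥0∞}
    (hL : LowerSemicontinuous L) (hH : LowerSemicontinuous fun p : Y × Y => H p.1 p.2) :
    LowerSemicontinuous (pairwiseEnergy L H) := by
  refine (lowerSemicontinuous_lintegral hL).add ?_
  exact (lowerSemicontinuous_lintegral hH).comp
    (ProbabilityMeasure.continuous_prod.comp (continuous_id.prodMk continuous_id))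

theorem exists_isMinimizer {μ : ProbabilityMeasure X} {c : X → Y → ℝ≥0∞}
    (hc : LowerSemicontinuous fun p : X × Y => c p.1 p.2) {L : Y → ℝ≥0∞} {H : Y → Y → ℝ≥0∞}
    (hL : LowerSemicontinuous L) (hH : LowerSemicontinuous fun p : Y × Y => H p.1 p.2)
    (hcpt : ∀ κ : ℝ≥0, 0 < κ → IsCompact {y : Y | L y ≤ (κ : ℝ≥0∞)})
    (hfin : (⨅ γ ∈ plans Y μ, liftedEnergy c (pairwiseEnergy L H) μ γ) < ⊤) :
    ∃ γ, IsMinimizer μ (liftedEnergy c (pairwiseEnergy L H) μ) γ := by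
  obtain ⟨γ₀, hγ₀, hlt⟩ : ∃ γ₀ ∈ plans Y μ, liftedEnergy c (pairwiseEnergy L H) μ γ₀ < ⊤ := by
    simpa [iInf_lt_iff] using hfin
  set J := liftedEnergy c (pairwiseEnergy L H) μ with hJ
  have hLJ : ∀ γ ∈ plans Y μ, ∫⁻ p, L p.2 ∂(γ : Measure (X × Y)) ≤ J γ := fun γ hγ => by
    rw [hJ, liftedEnergy_of_mem hγ, pairwiseEnergy]
    have : ∫⁻ y, L y ∂(margY γ : Measure Y) = ∫⁻ p, L p.2 ∂(γ : Measure (X × Y)) :=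
      lintegral_map hL.measurable measurable_snd
    rw [this]
    exact le_add_left le_self_add
  set S := plans Y μ ∩
    {γ : ProbabilityMeasure (X × Y) | ∫⁻ p, L p.2 ∂(γ : Measure (X × Y)) ≤ J γ₀}
  have hlsc : LowerSemicontinuous fun γ : ProbabilityMeasure (X × Y) =>
      (∫⁻ p, c p.1 p.2 ∂(γ : Measure (X × Y))) + pairwiseEnergy L H (margY γ) :=
    (lowerSemicontinuous_lintegral hc).add ((lowerSemicontinuous_pairwiseEnergy hL hH).comp
      (ProbabilityMeasure.continuous_map continuous_snd))
  obtain ⟨γ, hγ, hmin⟩ := LowerSemicontinuousOn.exists_isMinOn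
    (s := S) ⟨γ₀, hγ₀, hLJ γ₀ hγ₀⟩ (isCompact_plans_inter_lintegral_le μ hL hcpt hlt.ne)
    (hlsc.lowerSemicontinuousOn S)
  have hminJ : ∀ σ ∈ S, J γ ≤ J σ := fun σ hσ => by
    rw [hJ, liftedEnergy_of_mem hγ.1, liftedEnergy_of_mem hσ.1]
    exact hmin hσ
  refine ⟨γ, hγ.1, fun σ hσ => ?_⟩
  by_cases h : ∫⁻ p, L p.2 ∂(σ : Measure (X × Y)) ≤ J γ₀
  · exact hminJ σ ⟨hσ, h⟩
  · exact ((hminJ γ₀ ⟨hγ₀, hLJ γ₀ hγ₀⟩).trans (not_le.1 h).le).trans (hLJ σ hσ)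

end Existence

/-! ### Minimizers for pairwise interactions -/

section Interaction

variable {Y : Type*} [MeasurableSpace Y] {H : Y → Y → ℝ≥0∞}

theorem lintegral_lintegral_symm (hH : Measurable fun p : Y × Y => H p.1 p.2)
    (hsymm : ∀ y y', H y y' = H y' y) (a b : Measure Y) [SFinite a] [SFinite b] :
    ∫⁻ y, ∫⁻ y', H y y' ∂b ∂a = ∫⁻ y, ∫⁻ y', H y y' ∂a ∂b := by
  rw [lintegral_lintegral_swap hH.aemeasurable]
  simp_rw [hsymm]

theorem interaction_eq_lintegral (hH : Measurable fun p : Y × Y => H p.1 p.2)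
    (ν ν' : ProbabilityMeasure Y) :
    interaction H ν ν' = ∫⁻ y, ∫⁻ y', H y y' ∂(ν' : Measure Y) ∂(ν : Measure Y) :=
  lintegral_prod _ hH.aemeasurable

/-- For symmetric `H`, the interaction is a quadratic form along segments. -/
theorem interaction_convexMix (hH : Measurable fun p : Y × Y => H p.1 p.2)
    (hsymm : ∀ y y', H y y' = H y' y) (ν ν' : ProbabilityMeasure Y) (t : unitInterval) :
    interaction H (convexMix ν ν' t) (convexMix ν ν' t) =
      ENNReal.ofReal (1 - (t : ℝ)) ^ 2 * interaction H ν ν +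
        2 * ENNReal.ofReal (1 - (t : ℝ)) * ENNReal.ofReal (t : ℝ) * interaction H ν' ν +
          ENNReal.ofReal (t : ℝ) ^ 2 * interaction H ν' ν' := by
  have hm : ∀ ρ : ProbabilityMeasure Y, Measurable fun y => ∫⁻ y', H y y' ∂(ρ : Measure Y) :=
    fun ρ => hH.lintegral_prod_right'
  simp only [interaction_eq_lintegral hH, lintegral_convexMix]
  rw [lintegral_add_left ((hm ν).const_mul _), lintegral_add_left ((hm ν).const_mul _),
    lintegral_const_mul _ (hm ν), lintegral_const_mul _ (hm ν), lintegral_const_mul _ (hm ν'),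
    lintegral_const_mul _ (hm ν'),
    lintegral_lintegral_symm hH hsymm (ν : Measure Y) (ν' : Measure Y)]
  ring

end Interaction

section Pairwise

variable {X Y : Type*} [MeasurableSpace X] [MeasurableSpace Y] {c : X → Y → ℝ≥0∞} {L : Y → ℝ≥0∞}
  {H : Y → Y → ℝ≥0∞} {μ : ProbabilityMeasure X} {γ σ : ProbabilityMeasure (X × Y)}

theorem measurable_pairwiseCost (hc : Measurable fun p : X × Y => c p.1 p.2) (hL : Measurable L)
    (hH : Measurable fun p : Y × Y => H p.1 p.2) (ν : ProbabilityMeasure Y) :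
    Measurable fun p : X × Y => pairwiseCost c L H p.1 p.2 ν := by
  have h : Measurable fun y => ∫⁻ y', H y y' ∂(ν : Measure Y) := hH.lintegral_prod_right'
  exact (hc.add (hL.comp measurable_snd)).add ((h.comp measurable_snd).const_mul 2)

theorem lintegral_margY {f : Y → ℝ≥0∞} (hf : Measurable f) (σ : ProbabilityMeasure (X × Y)) :
    ∫⁻ y, f y ∂(margY σ : Measure Y) = ∫⁻ p, f p.2 ∂(σ : Measure (X × Y)) :=
  lintegral_map hf measurable_snd

theorem lintegral_pairwiseCost (hc : Measurable fun p : X × Y => c p.1 p.2) (hL : Measurable L)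
    (hH : Measurable fun p : Y × Y => H p.1 p.2) (ν : ProbabilityMeasure Y)
    (σ : ProbabilityMeasure (X × Y)) :
    ∫⁻ p, pairwiseCost c L H p.1 p.2 ν ∂(σ : Measure (X × Y)) =
      (∫⁻ p, c p.1 p.2 ∂(σ : Measure (X × Y))) + (∫⁻ y, L y ∂(margY σ : Measure Y)) +
        2 * interaction H (margY σ) ν := by
  have h : Measurable fun y => ∫⁻ y', H y y' ∂(ν : Measure Y) := hH.lintegral_prod_right'
  rw [lintegral_margY hL, interaction_eq_lintegral hH, lintegral_margY h,
    ← lintegral_add_left hc]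
  have h2 : 2 * ∫⁻ p, ∫⁻ y', H p.2 y' ∂(ν : Measure Y) ∂(σ : Measure (X × Y)) =
      ∫⁻ p, 2 * ∫⁻ y', H p.2 y' ∂(ν : Measure Y) ∂(σ : Measure (X × Y)) :=
    (lintegral_const_mul _ (h.comp measurable_snd)).symm
  rw [h2]
  exact lintegral_add_left (hc.add (hL.comp measurable_snd)) _

/-- First-order optimality condition: compare a minimizer with the points of the segment towards a
plan of finite self-interaction, along which the energy is a quadratic polynomial. -/
theorem IsMinimizer.lintegral_pairwiseCost_le (hc : Measurable fun p : X × Y => c p.1 p.2)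
    (hL : Measurable L) (hH : Measurable fun p : Y × Y => H p.1 p.2)
    (hsymm : ∀ y y', H y y' = H y' y)
    (hmin : IsMinimizer μ (liftedEnergy c (pairwiseEnergy L H) μ) γ)
    (hJ : liftedEnergy c (pairwiseEnergy L H) μ γ < ⊤) (hσ : σ ∈ plans Y μ)
    (hσH : interaction H (margY σ) (margY σ) < ⊤) :
    ∫⁻ p, pairwiseCost c L H p.1 p.2 (margY γ) ∂(γ : Measure (X × Y)) ≤
      ∫⁻ p, pairwiseCost c L H p.1 p.2 (margY γ) ∂(σ : Measure (X × Y)) := by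
  obtain ⟨hγ, hmin⟩ := hmin
  rw [lintegral_pairwiseCost hc hL hH, lintegral_pairwiseCost hc hL hH]
  have hmix : ∀ t : unitInterval, liftedEnergy c (pairwiseEnergy L H) μ γ ≤
      liftedEnergy c (pairwiseEnergy L H) μ (convexMix γ σ t) := fun t =>
    hmin (convexMix_mem_plans hγ hσ t)
  simp only [liftedEnergy_of_mem (convexMix_mem_plans hγ hσ _), margY_convexMix, pairwiseEnergy,
    interaction_convexMix hH hsymm, lintegral_convexMix, liftedEnergy_of_mem hγ] at hmix hJ
  generalize (∫⁻ p, c p.1 p.2 ∂(γ : Measure (X × Y))) = c₀ at *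
  generalize (∫⁻ p, c p.1 p.2 ∂(σ : Measure (X × Y))) = c₁ at *
  generalize (∫⁻ y, L y ∂(margY γ : Measure Y)) = l₀ at *
  generalize (∫⁻ y, L y ∂(margY σ : Measure Y)) = l₁ at *
  generalize interaction H (margY γ) (margY γ) = h₀ at *
  generalize interaction H (margY σ) (margY γ) = h₁ at *
  generalize interaction H (margY σ) (margY σ) = h₂ at *
  by_cases htop : c₁ + l₁ + 2 * h₁ = ⊤
  · rw [htop]; exact le_top
  have hc₀ : c₀ ≠ ⊤ := by rintro rfl; simp at hJ
  have hl₀ : l₀ ≠ ⊤ := by rintro rfl; simp at hJ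
  have hh₀ : h₀ ≠ ⊤ := by rintro rfl; simp at hJ
  have hc₁ : c₁ ≠ ⊤ := by rintro rfl; simp at htop
  have hl₁ : l₁ ≠ ⊤ := by rintro rfl; simp at htop
  have hh₁ : h₁ ≠ ⊤ := by rintro rfl; simp at htop
  lift c₀ to ℝ≥0 using hc₀
  lift l₀ to ℝ≥0 using hl₀
  lift h₀ to ℝ≥0 using hh₀
  lift c₁ to ℝ≥0 using hc₁
  lift l₁ to ℝ≥0 using hl₁
  lift h₁ to ℝ≥0 using hh₁
  lift h₂ to ℝ≥0 using hσH.ne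
  have hreal : ∀ t : ℝ, 0 ≤ t → t ≤ 1 → (c₀ : ℝ) + (l₀ + h₀) ≤
      (1 - t) * c₀ + t * c₁ + ((1 - t) * l₀ + t * l₁ +
        ((1 - t) ^ 2 * h₀ + 2 * (1 - t) * t * h₁ + t ^ 2 * h₂)) := by
    intro t ht0 ht1
    have h := hmix ⟨t, ht0, ht1⟩
    have e1 : ENNReal.ofReal (1 - t) = ((1 - t).toNNReal : ℝ≥0∞) := rfl
    have e2 : ENNReal.ofReal t = (t.toNNReal : ℝ≥0∞) := rfl
    simp only [e1, e2] at h
    norm_cast at h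
    have h' := NNReal.coe_le_coe.2 h
    push_cast [Real.coe_toNNReal _ ht0, Real.coe_toNNReal _ (sub_nonneg.2 ht1)] at h'
    exact h'
  norm_cast
  rw [← NNReal.coe_le_coe]
  push_cast
  by_contra! hlt
  set d : ℝ := (c₀ + l₀ + 2 * h₀) - (c₁ + l₁ + 2 * h₁) with hd
  set D : ℝ := h₀ - 2 * h₁ + h₂ with hD
  have hd0 : 0 < d := by linarith
  -- For this `t`, the first-order term `-t * d` dominates the second-order term `t ^ 2 * D`.
  set t : ℝ := d / (d + |D|) with ht
  have hpos : 0 < d + |D| := by positivity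
  have ht0 : 0 < t := div_pos hd0 hpos
  have ht1 : t ≤ 1 := (div_le_one hpos).2 (by linarith [abs_nonneg D])
  have h := hreal t ht0.le ht1
  have h' : t * d ≤ t * (t * D) := by
    rw [hd, hD]
    linarith
  have h'' : d ≤ t * D := le_of_mul_le_mul_left h' ht0
  have h3 : t * (d + |D|) = d := div_mul_cancel₀ _ hpos.ne'
  have h4 : t * D ≤ t * |D| := mul_le_mul_of_nonneg_left (le_abs_self D) ht0.le
  nlinarith [mul_pos ht0 hd0]

end Pairwise

section Resample

variable {X Y : Type*} [MeasurableSpace X] [MeasurableSpace Y]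

/-- The measure obtained from `γ` by drawing a new strategy from the law `η p` whenever
`p = (x, y)` lies in `A`, keeping the type `x`. -/
noncomputable def resample (γ : Measure (X × Y)) (A : Set (X × Y)) (η : Kernel (X × Y) Y) :
    Measure (X × Y) :=
  γ.restrict Aᶜ + ((γ.restrict A) ⊗ₘ η).map fun w => (w.1.1, w.2)

variable {γ : Measure (X × Y)} [IsFiniteMeasure γ] {A : Set (X × Y)} {η : Kernel (X × Y) Y}
  [IsMarkovKernel η]

theorem measurable_fst_fst_snd : Measurable fun w : (X × Y) × Y => (w.1.1, w.2) :=
  measurable_fst.fst.prodMk measurable_snd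

theorem map_fst_resample (hA : MeasurableSet A) :
    (resample γ A η).map Prod.fst = γ.map Prod.fst := by
  have h : ((γ.restrict A ⊗ₘ η).map fun w => (w.1.1, w.2)).map Prod.fst =
      (γ.restrict A).map Prod.fst := by
    rw [Measure.map_map measurable_fst measurable_fst_fst_snd]
    conv_rhs => rw [← Measure.fst_compProd (γ.restrict A) η, Measure.fst,
      Measure.map_map measurable_fst measurable_fst]
    rfl
  rw [resample, Measure.map_add _ _ measurable_fst, h, ← Measure.map_add _ _ measurable_fst,
    add_comm, Measure.restrict_add_restrict_compl hA]

theorem lintegral_resample {f : X × Y → ℝ≥0∞} (hf : Measurable f) :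
    ∫⁻ p, f p ∂(resample γ A η) =
      (∫⁻ p in Aᶜ, f p ∂γ) + ∫⁻ p in A, ∫⁻ z, f (p.1, z) ∂(η p) ∂γ := by
  rw [resample, lintegral_add_measure, lintegral_map hf measurable_fst_fst_snd]
  congr 1
  exact Measure.lintegral_compProd (hf.comp measurable_fst_fst_snd)

/-- The self-interaction of the second marginal of a resampled plan is finite when the pairwise
interactions of the new laws are bounded and each interacts boundedly with the old distribution. -/
theorem lintegral_lintegral_resample_lt_top {H : Y → Y → ℝ≥0∞}
    (hH : Measurable fun p : Y × Y => H p.1 p.2) (hsymm : ∀ y y', H y y' = H y' y)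
    {ν : Measure Y} (hν : ν = γ.map Prod.snd) (hA : MeasurableSet A)
    (hνν : ∫⁻ y, ∫⁻ y', H y y' ∂ν ∂ν < ⊤) {B C : ℝ≥0∞} (hB : B ≠ ⊤) (hC : C ≠ ⊤)
    (hηB : ∀ p ∈ A, ∫⁻ z, ∫⁻ y', H z y' ∂ν ∂(η p) ≤ B)
    (hηC : ∀ p ∈ A, ∀ p' ∈ A, ∫⁻ z, ∫⁻ z', H z z' ∂(η p') ∂(η p) ≤ C) :
    ∫⁻ y, ∫⁻ y', H y y' ∂((resample γ A η).map Prod.snd) ∂((resample γ A η).map Prod.snd) < ⊤ := by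
  set a : Measure Y := (γ.restrict Aᶜ).map Prod.snd with ha
  set b : Measure Y := (γ.restrict A ⊗ₘ η).map Prod.snd with hb
  have hsplit : (resample γ A η).map Prod.snd = a + b := by
    rw [resample, Measure.map_add _ _ measurable_snd,
      Measure.map_map measurable_snd measurable_fst_fst_snd]
    rfl
  have hfin : IsFiniteMeasure ν := hν ▸ inferInstance
  have hale : a ≤ ν := by
    rw [ha, hν]
    exact Measure.map_mono Measure.restrict_le_self measurable_snd
  have hm : ∀ (ρ : Measure Y) [SFinite ρ], Measurable fun y => ∫⁻ y', H y y' ∂ρ :=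
    fun ρ _ => hH.lintegral_prod_right'
  have hb_int : ∀ {f : Y → ℝ≥0∞}, Measurable f →
      ∫⁻ y, f y ∂b = ∫⁻ p in A, ∫⁻ z, f z ∂(η p) ∂γ := fun hf => by
    rw [hb, lintegral_map hf measurable_snd]
    exact Measure.lintegral_compProd (hf.comp measurable_snd)
  have hbound : ∀ {f : X × Y → ℝ≥0∞} {D : ℝ≥0∞}, D ≠ ⊤ → (∀ p ∈ A, f p ≤ D) →
      ∫⁻ p in A, f p ∂γ < ⊤ := fun {f D} hD hf =>
    calc ∫⁻ p in A, f p ∂γ ≤ ∫⁻ _p in A, D ∂γ := setLIntegral_mono' hA hf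
      _ = D * γ A := by simp
      _ < ⊤ := ENNReal.mul_lt_top hD.lt_top (measure_lt_top _ _)
  have haa : ∫⁻ y, ∫⁻ y', H y y' ∂a ∂a < ⊤ :=
    lt_of_le_of_lt (lintegral_mono' hale fun y => lintegral_mono' hale le_rfl) hνν
  have hba : ∫⁻ y, ∫⁻ y', H y y' ∂a ∂b < ⊤ := by
    refine lt_of_le_of_lt (lintegral_mono fun y => lintegral_mono' hale le_rfl) ?_
    rw [hb_int (hm ν)]
    exact hbound hB hηB
  have hbb : ∫⁻ y, ∫⁻ y', H y y' ∂b ∂b < ⊤ := by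
    rw [hb_int (hm b)]
    refine hbound (D := C * γ A) (ENNReal.mul_lt_top hC.lt_top (measure_lt_top _ _)).ne
      fun p hp => ?_
    have hswap : ∫⁻ z, ∫⁻ z', H z z' ∂b ∂(η p) =
        ∫⁻ p' in A, ∫⁻ z, ∫⁻ z', H z z' ∂(η p') ∂(η p) ∂γ := by
      have : ∀ z, ∫⁻ z', H z z' ∂b = ∫⁻ p' in A, ∫⁻ z', H z z' ∂(η p') ∂γ := fun z =>
        hb_int (hH.comp measurable_prodMk_left)
      simp_rw [this]
      refine lintegral_lintegral_swap (Measurable.aemeasurable ?_)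
      have h := Measurable.lintegral_kernel_prod_right' (κ := η.comap Prod.snd measurable_snd)
        (f := fun w : (Y × (X × Y)) × Y => H w.1.1 w.2)
        (hH.comp (measurable_fst.fst.prodMk measurable_snd))
      exact h
    rw [hswap]
    calc _ ≤ ∫⁻ _p' in A, C ∂γ := setLIntegral_mono' hA fun p' hp' => hηC p hp p' hp'
      _ = C * γ A := by simp
  rw [hsplit, lintegral_add_measure]
  simp only [lintegral_add_measure]
  rw [lintegral_add_left (hm a), lintegral_add_left (hm a), lintegral_lintegral_symm hH hsymm a b]
  exact ENNReal.add_lt_top.2 ⟨ENNReal.add_lt_top.2 ⟨haa, hba⟩, ENNReal.add_lt_top.2 ⟨hba, hbb⟩⟩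

end Resample

section Equilibrium

variable {X Y : Type*} [TopologicalSpace X] [PolishSpace X] [MeasurableSpace X] [BorelSpace X]
    [TopologicalSpace Y] [PolishSpace Y] [MeasurableSpace Y] [BorelSpace Y]
    {c : X → Y → ℝ≥0∞} {L : Y → ℝ≥0∞} {H : Y → Y → ℝ≥0∞} {μ : ProbabilityMeasure X}
    {γ : ProbabilityMeasure (X × Y)}

/-- A minimizer of finite energy is an equilibrium. Otherwise some measurable selection `s` improves
the cost by a fixed gap on a set of positive measure. Dirac masses at `s p` may have infinite
self-interaction, so the competitor draws the new strategies from the approximating laws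
`νₙ^(s p)`, with `n` fixed so large that on a smaller set of positive measure the improvement
persists. -/
theorem IsMinimizer.isCournotNash (hc : Measurable fun p : X × Y => c p.1 p.2)
    (hL : Measurable L) (hH : Measurable fun p : Y × Y => H p.1 p.2)
    (hsymm : ∀ y y', H y y' = H y' y) (happ : ApproximationCondition c L H)
    (hmin : IsMinimizer μ (liftedEnergy c (pairwiseEnergy L H) μ) γ)
    (hJ : liftedEnergy c (pairwiseEnergy L H) μ γ < ⊤) :
    IsCournotNash (fun x y ν => (pairwiseCost c L H x y ν : EReal)) μ γ := by
  have hγ := hmin.1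
  refine ⟨hγ, ?_⟩
  by_contra hne
  set ν := margY γ with hνdef
  set Φ : X → Y → ℝ≥0∞ := fun x y => pairwiseCost c L H x y ν with hΦdef
  have hΦ : Measurable fun p : X × Y => Φ p.1 p.2 := measurable_pairwiseCost hc hL hH ν
  obtain ⟨a', b', K, s, hab, hK, hs, hK0, hKs⟩ :=
    exists_measurable_improvement (γ : Measure (X × Y)) (Ψ := fun x y => (Φ x y : EReal))
      hΦ.coe_ereal_ennreal hne
  obtain ⟨a, b, hab, hKab⟩ : ∃ a b : ℝ≥0∞, a < b ∧
      ∀ p ∈ K, Φ p.1 (s p) ≤ a ∧ b ≤ Φ p.1 p.2 := by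
    obtain ⟨p₀, hp₀⟩ := nonempty_of_measure_ne_zero hK0
    have ha0 : (0 : ℝ) ≤ a' := by
      exact_mod_cast (EReal.coe_ennreal_nonneg _).trans (hKs p₀ hp₀).1
    refine ⟨ENNReal.ofReal a', ENNReal.ofReal b',
      (ENNReal.ofReal_lt_ofReal_iff (ha0.trans_lt hab)).2 hab, fun p hp => ⟨?_, ?_⟩⟩
    · simpa using! EReal.toENNReal_le_toENNReal (hKs p hp).1
    · simpa using! EReal.toENNReal_le_toENNReal (hKs p hp).2.le
  obtain ⟨m, ham, hmb⟩ := exists_between hab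
  have hm_top : m ≠ ⊤ := (hmb.trans_le le_top).ne
  obtain ⟨C, κ, hκ, -, happ⟩ := happ
  have hlt_top : ∀ p ∈ K, Φ p.1 (s p) < ⊤ := fun p hp =>
    (hKab p hp).1.trans_lt (ham.trans_le le_top)
  have hmeas : ∀ n, Measurable fun p : X × Y => ∫⁻ z, Φ p.1 z ∂(κ n (s p)) := fun n => by
    have h := Measurable.lintegral_kernel_prod_right' (κ := (κ n).comap s hs)
      (f := fun w : (X × Y) × Y => Φ w.1.1 w.2)
      (hΦ.comp (measurable_fst.fst.prodMk measurable_snd))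
    exact h
  obtain ⟨n, hn⟩ : ∃ n, (γ : Measure (X × Y)) (K ∩ {p | ∫⁻ z, Φ p.1 z ∂(κ n (s p)) ≤ m}) ≠ 0 := by
    by_contra! H0
    refine hK0 (measure_mono_null ?_ (measure_iUnion_null H0))
    intro p hp
    have hlim := (happ p.1 (s p) (s p) ν (hlt_top p hp)).2
    obtain ⟨n, hn⟩ := (hlim.eventually_lt_const ((hKab p hp).1.trans_lt ham)).exists
    exact Set.mem_iUnion.2 ⟨n, hp, hn.le⟩
  set A := K ∩ {p | ∫⁻ z, Φ p.1 z ∂(κ n (s p)) ≤ m} with hA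
  have hAm : MeasurableSet A := hK.inter (measurableSet_le (hmeas n) measurable_const)
  let η : Kernel (X × Y) Y := (κ n).comap s hs
  have : IsMarkovKernel η := inferInstance
  have hη : ∀ p, η p = κ n (s p) := fun p => rfl
  have hmap : (resample (γ : Measure (X × Y)) A η).map Prod.fst = μ :=
    (map_fst_resample hAm).trans (congrArg Subtype.val hγ)
  have hprob : IsProbabilityMeasure (resample (γ : Measure (X × Y)) A η) := by
    constructor
    rw [← Set.preimage_univ (f := Prod.fst), ← Measure.map_apply measurable_fst .univ, hmap]
    exact measure_univ
  let σ : ProbabilityMeasure (X × Y) := ⟨resample (γ : Measure (X × Y)) A η, hprob⟩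
  have hσ : σ ∈ plans Y μ := Subtype.ext hmap
  have hH0 : interaction H ν ν < ⊤ := by
    have := (liftedEnergy_lt_top_iff.1 hJ).2.2
    exact (ENNReal.add_lt_top.1 this).2
  have hσH : interaction H (margY σ) (margY σ) < ⊤ := by
    rw [interaction_eq_lintegral hH] at hH0 ⊢
    refine lintegral_lintegral_resample_lt_top (ν := (ν : Measure Y)) hH hsymm rfl hAm hH0 hm_top
      (C := (C n : ℝ≥0∞) * (1 + a + a)) ?_ ?_ ?_
    · have ha : a ≠ ⊤ := (ham.trans_le le_top).ne
      exact ENNReal.mul_ne_top ENNReal.coe_ne_top (by simp [ha])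
    · rintro p ⟨-, hp⟩
      refine le_trans (lintegral_mono fun z => ?_) hp
      calc ∫⁻ y', H z y' ∂(ν : Measure Y) ≤ 2 * ∫⁻ y', H z y' ∂(ν : Measure Y) :=
            le_mul_of_one_le_left' one_le_two
        _ ≤ Φ p.1 z := le_add_self
    · rintro p ⟨hp, -⟩ p' ⟨hp', -⟩
      have hLle : ∀ q ∈ K, L (s q) ≤ a := fun q hq =>
        (le_add_self.trans le_self_add).trans (hKab q hq).1
      have h := (happ p.1 (s p) (s p') ν (hlt_top p hp)).1 n
      rw [lintegral_prod _ hH.aemeasurable] at h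
      refine h.trans ?_
      gcongr
      exacts [hLle p hp, hLle p' hp']
  have hle := hmin.lintegral_pairwiseCost_le hc hL hH hsymm hJ hσ hσH
  -- The competitor is strictly cheaper for the cost `Φ`.
  have hγfin : ∫⁻ p, Φ p.1 p.2 ∂(γ : Measure (X × Y)) < ⊤ := by
    obtain ⟨-, h1, h2⟩ := liftedEnergy_lt_top_iff.1 hJ
    rw [lintegral_pairwiseCost hc hL hH]
    exact ENNReal.add_lt_top.2 ⟨ENNReal.add_lt_top.2 ⟨h1, (ENNReal.add_lt_top.1 h2).1⟩,
      ENNReal.mul_lt_top (by simp) hH0⟩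
  have hσ_le : ∫⁻ p, Φ p.1 p.2 ∂(σ : Measure (X × Y)) ≤
      (∫⁻ p in Aᶜ, Φ p.1 p.2 ∂(γ : Measure (X × Y))) + m * (γ : Measure (X × Y)) A := by
    refine (lintegral_resample hΦ).trans_le (add_le_add_right ?_ _)
    calc _ ≤ ∫⁻ _p in A, m ∂(γ : Measure (X × Y)) := setLIntegral_mono' hAm fun p hp => hp.2
      _ = _ := by simp
  have hγ_ge : (∫⁻ p in Aᶜ, Φ p.1 p.2 ∂(γ : Measure (X × Y))) + b * (γ : Measure (X × Y)) A ≤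
      ∫⁻ p, Φ p.1 p.2 ∂(γ : Measure (X × Y)) := by
    rw [← lintegral_add_compl (μ := (γ : Measure (X × Y))) (fun p => Φ p.1 p.2) hAm, add_comm]
    refine add_le_add_left ?_ _
    calc b * (γ : Measure (X × Y)) A = ∫⁻ _p in A, b ∂(γ : Measure (X × Y)) := by simp
      _ ≤ _ := setLIntegral_mono' hAm fun p hp => (hKab p hp.1).2
  have hAc : ∫⁻ p in Aᶜ, Φ p.1 p.2 ∂(γ : Measure (X × Y)) ≠ ⊤ :=
    ((setLIntegral_le_lintegral _ _).trans_lt hγfin).ne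
  have hle' := (hγ_ge.trans hle).trans hσ_le
  rw [ENNReal.add_le_add_iff_left hAc] at hle'
  exact absurd hle' (not_le.2 (ENNReal.mul_lt_mul_left hn (measure_ne_top _ _) hmb))

end Equilibrium

end CournotNash

theorem theorem3p3 {X Y : Type*}
    [TopologicalSpace X] [PolishSpace X] [MeasurableSpace X] [BorelSpace X]
    [TopologicalSpace Y] [PolishSpace Y] [MeasurableSpace Y] [BorelSpace Y]
    (μ : ProbabilityMeasure X) (c : X → Y → ℝ≥0∞)
    (hc : LowerSemicontinuous fun p : X × Y => c p.1 p.2) :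
    (∀ (E : ProbabilityMeasure Y → ℝ≥0∞) (dE : ProbabilityMeasure Y → Y → EReal)
        (γ : ProbabilityMeasure (X × Y)),
      LowerSemicontinuous E →
      γ ∈ CournotNash.plans Y μ →
      CournotNash.IsFirstVariation E (CournotNash.margY γ) (dE (CournotNash.margY γ)) →
      -- a direction along which the first variation is integrable is admissible for `E`
      (∀ ν' : ProbabilityMeasure Y,
        CournotNash.ExtIntegrable (dE (CournotNash.margY γ)) ν' →
        ∃ t : unitInterval, 0 < t ∧
          E (CournotNash.convexMix (CournotNash.margY γ) ν' t) < ⊤) →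
      (LowerSemicontinuous fun p : X × Y =>
        CournotNash.potentialCost c dE p.1 p.2 (CournotNash.margY γ)) →
      (∀ (x : X) (ℓ : ℝ),
        IsCompact {y : Y |
          CournotNash.potentialCost c dE x y (CournotNash.margY γ) ≤ (ℓ : EReal)}) →
      (CournotNash.liftedEnergy c E μ γ < ⊤ →
        (CournotNash.IsCournotNash (CournotNash.potentialCost c dE) μ γ ↔
          CournotNash.IsCriticalPoint (CournotNash.liftedEnergy c E μ) γ)) ∧
      (CournotNash.IsCournotNash (CournotNash.potentialCost c dE) μ γ →
        CournotNash.IsFiniteSocialCostDistribution (CournotNash.potentialCost c dE) μ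
          (CournotNash.margY γ) →
        CournotNash.HasFiniteSocialCost (CournotNash.potentialCost c dE) γ)) ∧
    (∀ (L : Y → ℝ≥0∞) (H : Y → Y → ℝ≥0∞),
      LowerSemicontinuous L →
      (LowerSemicontinuous fun p : Y × Y => H p.1 p.2) →
      (∀ y y' : Y, H y y' = H y' y) →
      (∀ κ : ℝ≥0, 0 < κ → IsCompact {y : Y | L y ≤ (κ : ℝ≥0∞)}) →
      (⨅ γ ∈ CournotNash.plans Y μ,
        CournotNash.liftedEnergy c (CournotNash.pairwiseEnergy L H) μ γ) < ⊤ →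
      (∃ γ, CournotNash.IsMinimizer μ
        (CournotNash.liftedEnergy c (CournotNash.pairwiseEnergy L H) μ) γ) ∧
      (CournotNash.ApproximationCondition c L H →
        ∀ γ, CournotNash.IsMinimizer μ
            (CournotNash.liftedEnergy c (CournotNash.pairwiseEnergy L H) μ) γ →
          CournotNash.IsCournotNash
            (fun x y ν => (CournotNash.pairwiseCost c L H x y ν : EReal)) μ γ)) := by
  have hcm := hc.measurable
  refine ⟨fun E dE γ _ _ hf hadm _ _ =>
    ⟨CournotNash.isCournotNash_iff_isCriticalPoint hcm hf hadm, fun hγ hfin =>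
      hγ.hasFiniteSocialCost hfin⟩, fun L H hL hH hsymm hcpt hfin =>
    ⟨CournotNash.exists_isMinimizer hc hL hH hcpt hfin, fun happ γ hγ => ?_⟩⟩
  refine hγ.isCournotNash hcm hL.measurable hH.measurable hsymm happ ?_
  exact (le_iInf₂ fun σ hσ => hγ.2 hσ).trans_lt hfin
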